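/- **Setting.** Let $f:\mathbb{R}^d\to\mathbb{R}$ be measurable, let $p_u\ge 0$ be a measurable, integrable function on $\mathbb{R}^d$ with $c_p=\int p_u(x)\,dx>0$, and let $p=p_u/c_p$. Suppose $\int|f|p\,dx<\infty$, put $\mu_0=\int f(x)p(x)\,dx$, and suppose $0<\int (f(x)-\mu_0)^2p(x)\,dx<\infty$. Write $a_+=\max(a,0)$, $a_-=\max(-a,0)$. For probability densities $q_+,q_-$ on $\mathbb{R}^d$, let $x_{1+},x_{2+},\dots$ be i.i.d. from $q_+$ and, independently of them, $x_{1-},x_{2-},\dots$ be i.i.d. from $q_-$, and put $$\Psi_{n_+,n_-}(\mu)=\frac1{n_+}\sum_{i=1}^{n_+}\frac{(f(x_{i+})-\mu)_+\,p_u(x_{i+})}{q_+(x_{i+})}-\frac1{n_-}\sum_{i=1}^{n_-}\frac{(f(x_{i-})-\mu)_-\,p_u(x_{i-})}{q_-(x_{i-})}.$$ Let $$\sigma_\pm^2=\int\frac{\bigl[(f(x)-\mu_0)_\pm\, p(x)-m_\pm q_\pm(x)\bigr]^2}{q_\pm(x)}\,dx\in[0,\infty],\qquad m_\pm=\int (f(x)-\mu_0)_\pm\,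 p(x)\,dx$$ (with the convention $0/0=0$). Call $q_\pm$ *admissible* if, for some $\eta>0$ and simultaneously for all $\mu\in(\mu_0-\eta,\mu_0+\eta)$, $q_\pm(x)>0$ whenever $(f(x)-\mu)_\pm\, p_u(x)>0$ (respectively). Let $n_\pm=n_\pm(n)$ be nondecreasing nonnegative integer functions of $n$ with $\min(n_+,n_-)\to\infty$, $n_+/n\to\theta\in(0,1)$ and $n_- /n\to1-\theta$. **Theorem 1.** 1. Let $q_\pm$ be admissible probability densities with $\sigma_\pm^2<\infty$ and $\sigma_+^2/\theta+\sigma_-^2/(1-\theta)>0$. Suppose that, with probability tending to one as $n\to\infty$, $\hat\mu=\hat\mu_n$ is the unique zero of $\Psi_{n_+,n_-}$ (in particular, this holds if $\hat\mu_n$ is almost surely the unique zero for all sufficiently large $n$). Then for all $t\in\mathbb{R}$, $$\lim_{n\to\infty}\Pr\left(\frac{\sqrt n\,(\hat\mu-\mu_0)}{\sqrt{\sigma_+^2/\theta+\sigma_-^2/(1-\theta)}}\le t\right)=\Phi(t),$$ where $\Phi$ is the $\mathcal N(0,1)$ cumulative distribution function. 2. The asymptotic variance can be made arbitrarily small by taking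 $q_\pm$ close to the densities $q_\pm^*=(f-\mu_0)_\pm\, p/m_\pm$: for every $\varepsilon>0$ there are admissible probability densities $q_\pm$ with $\sigma_\pm^2<\infty$, $\int|q_\pm-q_\pm^*|\,dx<\varepsilon$ and $$0<\frac{\sigma_+^2}{\theta}+\frac{\sigma_-^2}{1-\theta}<\varepsilon,$$ for which, almost surely, $\Psi_{n_+,n_-}$ has a unique zero for all sufficiently large $n$. -/

import Mathlib

open MeasureTheory ProbabilityTheory Filter Topology Set
open scoped ENNReal

noncomputable section

namespace EESNIS

/-- The normalizing constant `c_p = ∫ p_u(x) dx` of an unnormalized density. -/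
def normConst {d : ℕ} (pu : EuclideanSpace ℝ (Fin d) → ℝ) : ℝ :=
  ∫ x, pu x

/-- The normalized target density `p = p_u / c_p`. -/
def target {d : ℕ} (pu : EuclideanSpace ℝ (Fin d) → ℝ) (x : EuclideanSpace ℝ (Fin d)) : ℝ :=
  pu x / normConst pu

/-- The estimand `μ₀ = ∫ f(x) p(x) dx`. -/
def mean {d : ℕ} (f pu : EuclideanSpace ℝ (Fin d) → ℝ) : ℝ :=
  ∫ x, f x * target pu x

/-- `q` is a probability density function on `ℝ^d` with respect to Lebesgue measure. -/
structure IsPDF {d : ℕ} (q : EuclideanSpace ℝ (Fin d) → ℝ) : Prop where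
  measurable : Measurable q
  nonneg : ∀ x, 0 ≤ q x
  integral_eq_one : ∫ x, q x = 1

/-- The probability distribution with density `q`. -/
def law {d : ℕ} (q : EuclideanSpace ℝ (Fin d) → ℝ) : Measure (EuclideanSpace ℝ (Fin d)) :=
  volume.withDensity fun x => ENNReal.ofReal (q x)

/-- The support condition: for some `η > 0`, simultaneously for all `μ ∈ (μ₀ - η, μ₀ + η)`,
`q_±(x) > 0` whenever `(f(x) - μ)_± p_u(x) > 0`, respectively. -/
def SupportCondition {d : ℕ} (f pu qp qm : EuclideanSpace ℝ (Fin d) → ℝ) : Prop :=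
  ∃ η : ℝ, 0 < η ∧ ∀ μ ∈ Ioo (mean f pu - η) (mean f pu + η), ∀ x,
    (0 < (f x - μ)⁺ * pu x → 0 < qp x) ∧ (0 < (f x - μ)⁻ * pu x → 0 < qm x)

/-- The estimating function
`Ψ_{n₊,n₋}(μ) = (1/n₊) ∑ (f(x_{i+}) - μ)_+ p_u(x_{i+}) / q_+(x_{i+})
  - (1/n₋) ∑ (f(x_{i-}) - μ)_- p_u(x_{i-}) / q_-(x_{i-})`,
computed from the first `n₊` points of `xp` and the first `n₋` points of `xm`. -/
def psi {d : ℕ} (f pu qp qm : EuclideanSpace ℝ (Fin d) → ℝ) (np nm : ℕ)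
    (xp xm : ℕ → EuclideanSpace ℝ (Fin d)) (μ : ℝ) : ℝ :=
  (1 / (np : ℝ)) * ∑ i ∈ Finset.range np, (f (xp i) - μ)⁺ * pu (xp i) / qp (xp i)
    - (1 / (nm : ℝ)) * ∑ i ∈ Finset.range nm, (f (xm i) - μ)⁻ * pu (xm i) / qm (xm i)

/-- `Xp` is an i.i.d. sequence from `q_+` and, independently of it, `Xm` is an i.i.d. sequence
from `q_-`. -/
structure IsSample {d : ℕ} {Ω : Type*} [MeasurableSpace Ω] (P : Measure Ω)
    (qp qm : EuclideanSpace ℝ (Fin d) → ℝ)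
    (Xp Xm : ℕ → Ω → EuclideanSpace ℝ (Fin d)) : Prop where
  law_pos : ∀ i, HasLaw (Xp i) (law qp) P
  law_neg : ∀ i, HasLaw (Xm i) (law qm) P
  indep_pos : iIndepFun Xp P
  indep_neg : iIndepFun Xm P
  indep : IndepFun (fun ω i => Xp i ω) (fun ω i => Xm i ω) P

/-- The integrand `(f - μ₀)_+ p`. -/
def posIntegrand {d : ℕ} (f pu : EuclideanSpace ℝ (Fin d) → ℝ)
    (x : EuclideanSpace ℝ (Fin d)) : ℝ :=
  (f x - mean f pu)⁺ * target pu x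

/-- The integrand `(f - μ₀)_- p`. -/
def negIntegrand {d : ℕ} (f pu : EuclideanSpace ℝ (Fin d) → ℝ)
    (x : EuclideanSpace ℝ (Fin d)) : ℝ :=
  (f x - mean f pu)⁻ * target pu x

/-- The ordinary importance sampling variance `∫ (g - m q)² / q dx ∈ [0, ∞]`, `m = ∫ g dx`, of
one draw of `g(x) / q(x)`, `x ∼ q`. In `[0, ∞]` one has `0 / 0 = 0` and `a / 0 = ∞` for `a > 0`, so
points with `q = g = 0` contribute nothing. -/
def oisVar {d : ℕ} (g q : EuclideanSpace ℝ (Fin d) → ℝ) : ℝ≥0∞ :=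
  ∫⁻ x, ENNReal.ofReal ((g x - (∫ y, g y) * q x) ^ 2) / ENNReal.ofReal (q x)

/-- The asymptotic variance `σ²_+ / θ + σ²_- / (1 - θ)`. -/
def asympVar {d : ℕ} (f pu qp qm : EuclideanSpace ℝ (Fin d) → ℝ) (θ : ℝ) : ℝ :=
  (oisVar (posIntegrand f pu) qp).toReal / θ + (oisVar (negIntegrand f pu) qm).toReal / (1 - θ)

/-- `g / ∫ g`, the density proportional to the nonnegative function `g`. -/
def normalized {d : ℕ} (g : EuclideanSpace ℝ (Fin d) → ℝ) (x : EuclideanSpace ℝ (Fin d)) : ℝ :=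
  g x / ∫ y, g y

/-- `m` is a zero of `Ψ`, and the only one. -/
def IsUniqueZero (Ψ : ℝ → ℝ) (m : ℝ) : Prop :=
  Ψ m = 0 ∧ ∀ μ, Ψ μ = 0 → μ = m

end EESNIS

end

/-! `psi` is antitone in `μ`, so when `μhat` is its only zero, `μhat ≤ s` exactly when `psi` is
nonpositive at `s` (`IsUniqueZero.le_iff_of_antitone`). With `s = μ₀ + a / √n` and `a = σ t`, the
limit theorem for the zero becomes one for `√n Ψ(μ₀ + a / √n) / c_p` at a deterministic point; no
consistency argument or expansion at a random point is needed.

By `sqrt_mul_psi_eq` this quantity is a fluctuation minus a drift. The fluctuation is `√n` times the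
difference of two importance sampling averages at `μ₀`. Both have mean `m`, because `∫ (f - μ₀) p =
0`, so it is asymptotically `N(0, σ²)` by independence. The drift averages increments lying between
`0` and `a`, weighted by `p / q`. A dominated law of large numbers gives limits for its two halves,
which add up to `a ∫ p = a`. Hence the limit is `N(0, σ²) - a`, which is nonpositive with
probability `Φ(t)`. Mass of `p` on `{f = μ₀}` is only split between the two halves; that both
samplers see it is what the support condition on a neighbourhood of `μ₀` provides.

For the second part, mix a fraction `δ` of `p` into each optimal density. The variance is then
`O(δ)` (`oisVar_defensiveMixture_le`), and it is not zero, as otherwise `(f - μ₀)₊` would be a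
positive constant `p`-almost everywhere. Zeros exist by the intermediate value theorem, and are
unique once some positive-sample point has a larger `f` than some negative-sample point
(`exists_isUniqueZero_psi`), which almost surely happens eventually. -/

noncomputable section

namespace EESNIS

/-! ### Limit theorems for i.i.d. averages -/

section Limits

variable {Ω : Type*} [MeasurableSpace Ω] {P : Measure Ω}

/-- The sum of two independent asymptotically Gaussian sequences is asymptotically Gaussian. -/
theorem tendstoInDistribution_add_gaussianReal [IsProbabilityMeasure P]
    {A B : ℕ → Ω → ℝ} {v w : NNReal}
    (hA : TendstoInDistribution A atTop id (fun _ => P) (gaussianReal 0 v))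
    (hB : TendstoInDistribution B atTop id (fun _ => P) (gaussianReal 0 w))
    (hAB : ∀ n, IndepFun (A n) (B n) P) :
    TendstoInDistribution (fun n ω => A n ω + B n ω) atTop id (fun _ => P)
      (gaussianReal 0 (v + w)) where
  forall_aemeasurable n := (hA.forall_aemeasurable n).add (hB.forall_aemeasurable n)
  tendsto := by
    refine ProbabilityMeasure.tendsto_iff_tendsto_charFun.2 fun t => ?_
    have h1 := ProbabilityMeasure.tendsto_iff_tendsto_charFun.1 hA.tendsto t
    have h2 := ProbabilityMeasure.tendsto_iff_tendsto_charFun.1 hB.tendsto t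
    have h3 := h1.mul h2
    simp only [ProbabilityMeasure.coe_mk, Measure.map_id, charFun_gaussianReal] at h3 ⊢
    convert h3 using 2 with n
    · rw [(hAB n).charFun_map_fun_add_eq_mul (hA.forall_aemeasurable n)
        (hB.forall_aemeasurable n)]
      rfl
    · rw [← Complex.exp_add]
      congr 1
      push_cast
      ring

/-- Scaling an asymptotically Gaussian sequence by a convergent sequence of constants. -/
theorem tendstoInDistribution_const_mul_gaussianReal [IsProbabilityMeasure P]
    {A : ℕ → Ω → ℝ} {v : NNReal}
    (hA : TendstoInDistribution A atTop id (fun _ => P) (gaussianReal 0 v))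
    {c : ℕ → ℝ} {c₀ : ℝ} (hc : Tendsto c atTop (𝓝 c₀)) :
    TendstoInDistribution (fun n ω => c n * A n ω) atTop id (fun _ => P)
      (gaussianReal 0 (NNReal.mk (c₀ ^ 2) (sq_nonneg _) * v)) := by
  have h := hA.continuous_comp_prodMk_of_tendstoInMeasure_const
    (g := fun x : ℝ × ℝ => x.2 * x.1) (by fun_prop) (Y := fun n _ => c n) (c := c₀)
    (tendstoInMeasure_of_tendsto_ae (fun n => by fun_prop) (by simpa using hc))
    (fun n => by fun_prop)
  refine ⟨h.forall_aemeasurable, aemeasurable_id, ?_⟩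
  convert h.tendsto using 2
  congr 1
  apply Subtype.ext
  change Measure.map id _ = Measure.map (fun x => c₀ * id x) _
  have := gaussianReal_map_const_mul (μ := 0) (v := v) c₀
  rw [mul_zero] at this
  rw [Measure.map_id, ← this]
  rfl

/-- The central limit theorem along sample sizes `k n` with `k n / n → θ`. -/
theorem tendstoInDistribution_sqrt_mul_average_sub [IsProbabilityMeasure P]
    {U : ℕ → Ω → ℝ} (hU : MemLp (U 0) 2 P)
    (hind : iIndepFun U P) (hident : ∀ i, IdentDistrib (U i) (U 0) P P)
    {k : ℕ → ℕ} (hk : Tendsto k atTop atTop) {θ : ℝ} (hθ : 0 < θ)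
    (hkθ : Tendsto (fun n => (k n : ℝ) / (n : ℝ)) atTop (𝓝 θ)) :
    TendstoInDistribution
      (fun (n : ℕ) ω => √(n : ℝ) * ((1 / (k n : ℝ)) * ∑ i ∈ Finset.range (k n), (U i ω - P[U 0])))
      atTop id (fun _ => P) (gaussianReal 0 (Var[U 0; P] / θ).toNNReal) := by
  have h0 := tendstoInDistribution_inv_sqrt_mul_sum_sub (P' := gaussianReal 0 Var[U 0; P].toNNReal)
    HasLaw.id hU hind hident
  have h1 : TendstoInDistribution
      (fun n ω => (√(k n : ℝ))⁻¹ * (∑ i ∈ Finset.range (k n), U i ω - k n * P[U 0]))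
      atTop id (fun _ => P) (gaussianReal 0 Var[U 0; P].toNNReal) :=
    ⟨fun n => h0.forall_aemeasurable (k n), h0.aemeasurable_limit, h0.tendsto.comp hk⟩
  -- `√n / k = √(n / k) · k^(-1/2)`: the first factor is deterministic and the second is the usual
  -- normalization.
  have hc : Tendsto (fun n => √(((k n : ℝ) / (n : ℝ))⁻¹)) atTop (𝓝 (√(θ⁻¹))) :=
    (hkθ.inv₀ hθ.ne').sqrt
  have h2 := tendstoInDistribution_const_mul_gaussianReal h1 hc
  convert h2 using 3
  · rename_i n ω
    rw [Finset.sum_sub_distrib, Finset.sum_const, Finset.card_range, nsmul_eq_mul, inv_div,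
      Real.sqrt_div (Nat.cast_nonneg n)]
    rcases Nat.eq_zero_or_pos (k n) with hn | hn
    · simp [hn]
    · have : 0 < (k n : ℝ) := by exact_mod_cast hn
      have h3 := Real.mul_self_sqrt this.le
      have h4 : √(k n : ℝ) ≠ 0 := (Real.sqrt_pos.2 this).ne'
      rw [← mul_assoc, ← mul_assoc]
      congr 1
      nth_rewrite 1 [← h3]
      field_simp
  · apply NNReal.coe_injective
    rw [Real.coe_toNNReal _ (div_nonneg (variance_nonneg _ _) hθ.le), NNReal.coe_mul, NNReal.coe_mk,
      Real.coe_toNNReal _ (variance_nonneg _ _), Real.sq_sqrt (inv_nonneg.2 hθ.le)]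
    field_simp

/-- The averages of `φ n` over the first `k n` points of an i.i.d. sample from `ν` converge in
probability to `∫ φ dν` when `φ n → φ` dominatedly. -/
theorem tendstoInMeasure_average_of_dominated {E : Type*} [MeasurableSpace E] {ν : Measure E}
    {X : ℕ → Ω → E} (hX : ∀ i, HasLaw (X i) ν P) (hind : iIndepFun X P)
    {φ : ℕ → E → ℝ} {φ₀ g : E → ℝ} (hφ : ∀ n, Measurable (φ n)) (hφ₀ : Measurable φ₀)
    (hg : Integrable g ν) (hbd : ∀ n x, |φ n x| ≤ g x)
    (hlim : ∀ x, Tendsto (fun n => φ n x) atTop (𝓝 (φ₀ x)))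
    {k : ℕ → ℕ} (hk : Tendsto k atTop atTop) :
    TendstoInMeasure P
      (fun n ω => (1 / (k n : ℝ)) * ∑ i ∈ Finset.range (k n), φ n (X i ω)) atTop
      (fun _ => ∫ x, φ₀ x ∂ν) := by
  have hbd₀ : ∀ x, |φ₀ x| ≤ g x := fun x =>
    le_of_tendsto' (hlim x).abs fun n => hbd n x
  have hφ₀i : Integrable φ₀ ν := hg.mono' hφ₀.aestronglyMeasurable (ae_of_all _ hbd₀)
  have hmap : ∀ i, Measure.map (X i) P = ν := fun i => (hX i).map_eq
  have hXm : ∀ i, AEMeasurable (X i) P := fun i => (hX i).aemeasurable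
  have hcomp : ∀ {h : E → ℝ}, Measurable h → ∀ i, AEMeasurable (fun ω => h (X i ω)) P :=
    fun hh i => hh.comp_aemeasurable (hXm i)
  -- the law of large numbers for the limit function
  have hslln := strong_law_Lp (μ := P) (p := 1) le_rfl ENNReal.one_ne_top
    (fun i ω => φ₀ (X i ω))
    (memLp_one_iff_integrable.2 ((hmap 0 ▸ hφ₀i : Integrable φ₀ (P.map (X 0))).comp_aemeasurable
      (hXm 0)))
    (fun i j hij => (hind.indepFun hij).comp hφ₀ hφ₀)
    (fun i => ((hX i).identDistrib (hX 0)).comp hφ₀)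
  have hmean : ∫ ω, φ₀ (X 0 ω) ∂P = ∫ x, φ₀ x ∂ν :=
    (hX 0).integral_comp hφ₀.aestronglyMeasurable
  rw [hmean] at hslln
  -- The law of large numbers covers only the fixed `φ₀`. Every summand has law `ν`, so replacing `φ
  -- n` by `φ₀` in the average costs at most this norm, whatever the sample size.
  have hdom : Tendsto (fun n => eLpNorm (fun x => φ n x - φ₀ x) 1 ν) atTop (𝓝 0) := by
    simp_rw [eLpNorm_one_eq_lintegral_enorm]
    have := tendsto_lintegral_of_dominated_convergence (μ := ν)
      (F := fun n x => ‖φ n x - φ₀ x‖ₑ) (f := fun _ => 0) (fun x => ‖g x + g x‖ₑ)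
      (fun n => ((hφ n).sub hφ₀).enorm) (fun n => ae_of_all _ fun x => ?_)
      (hg.add hg).2.ne (ae_of_all _ fun x => ?_)
    · simpa using this
    · rw [enorm_le_iff_norm_le, Real.norm_eq_abs, Real.norm_eq_abs]
      exact (abs_sub _ _).trans ((add_le_add (hbd n x) (hbd₀ x)).trans (le_abs_self _))
    · have := ((hlim x).sub_const (φ₀ x)).enorm
      simpa using this
  refine tendstoInMeasure_of_tendsto_eLpNorm one_ne_zero (fun n => ?_) (by fun_prop) ?_
  · exact ((Finset.aemeasurable_fun_sum _ fun i _ =>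
      hcomp (hφ n) i).const_mul _).aestronglyMeasurable
  refine tendsto_of_tendsto_of_tendsto_of_le_of_le tendsto_const_nhds
    (by simpa using hdom.add (hslln.comp hk)) (fun _ => zero_le) fun n => ?_
  have hdecomp : (fun ω => (1 / (k n : ℝ)) * ∑ i ∈ Finset.range (k n), φ n (X i ω))
      - (fun _ => ∫ x, φ₀ x ∂ν)
      = ((1 / (k n : ℝ)) • ∑ i ∈ Finset.range (k n), fun ω => φ n (X i ω) - φ₀ (X i ω))
        + fun ω => (k n : ℝ)⁻¹ • (∑ i ∈ Finset.range (k n), φ₀ (X i ω)) - ∫ x, φ₀ x ∂ν := by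
    funext ω
    simp only [Pi.sub_apply, Pi.add_apply, Pi.smul_apply, Finset.sum_apply, smul_eq_mul,
      Finset.sum_sub_distrib]
    ring
  rw [hdecomp]
  have hm : ∀ i, AEStronglyMeasurable (fun ω => φ n (X i ω) - φ₀ (X i ω)) P := fun i =>
    ((hcomp (hφ n) i).sub (hcomp hφ₀ i)).aestronglyMeasurable
  refine (eLpNorm_add_le ((Finset.aestronglyMeasurable_sum _ fun i _ => hm i).const_smul _) ?_
    le_rfl).trans (add_le_add ?_ le_rfl)
  · exact (((Finset.aemeasurable_fun_sum _ fun i _ => hcomp hφ₀ i).const_mul _).sub_const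
      _).aestronglyMeasurable
  · rw [eLpNorm_const_smul]
    have hterm : ∀ i, eLpNorm (fun ω => φ n (X i ω) - φ₀ (X i ω)) 1 P
        = eLpNorm (fun x => φ n x - φ₀ x) 1 ν := fun i => by
      rw [← hmap i]
      exact (eLpNorm_map_measure ((hφ n).sub hφ₀).aestronglyMeasurable (hXm i)).symm
    refine (mul_le_mul_right (eLpNorm_sum_le (fun i _ => hm i) le_rfl) _).trans ?_
    simp_rw [hterm]
    rw [Finset.sum_const, Finset.card_range, nsmul_eq_mul, ← mul_assoc]
    rcases Nat.eq_zero_or_pos (k n) with hn | hn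
    · simp [hn]
    · have hn' : (0 : ℝ) < k n := by exact_mod_cast hn
      have : ‖(1 / (k n : ℝ))‖ₑ * (k n : ℝ≥0∞) = 1 := by
        rw [Real.enorm_of_nonneg (by positivity), ← ENNReal.ofReal_natCast,
          ← ENNReal.ofReal_mul (by positivity), one_div_mul_cancel hn'.ne', ENNReal.ofReal_one]
      rw [this, one_mul]

/-- Limits of the distribution function at `0` from convergence in distribution. -/
theorem tendsto_measureReal_nonpos [IsProbabilityMeasure P]
    {A : ℕ → Ω → ℝ} {b s t : ℝ} (hs : 0 < s) (hb : b = s * t)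
    (hA : TendstoInDistribution A atTop (fun x => x - b) (fun _ => P)
      (gaussianReal 0 (s ^ 2).toNNReal)) :
    Tendsto (fun n => P.real {ω | A n ω ≤ 0}) atTop (𝓝 (cdf (gaussianReal 0 1) t)) := by
  -- In terms of a standard Gaussian `Z` the limit is `s Z - b`, so `Iic 0` pulls back to `Z ≤ t`
  -- and its frontier to the null set `{t}`.
  have hmap : Measure.map (fun x => s * x - b) (gaussianReal 0 1)
      = Measure.map (fun x => x - b) (gaussianReal 0 (s ^ 2).toNNReal) := by
    have h := gaussianReal_map_const_mul (μ := 0) (v := 1) s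
    rw [mul_zero, mul_one] at h
    have h' : (s ^ 2).toNNReal = NNReal.mk (s ^ 2) (sq_nonneg _) :=
      Real.toNNReal_of_nonneg (sq_nonneg _)
    rw [h', ← h, Measure.map_map (by fun_prop) (by fun_prop)]
    rfl
  have hpre : (fun x => s * x - b) ⁻¹' Iic 0 = Iic t := by
    ext x
    simp only [mem_preimage, mem_Iic, hb]
    constructor
    · intro h
      nlinarith
    · intro h
      nlinarith
  have hpre0 : (fun x => s * x - b) ⁻¹' {0} = {t} := by
    ext x
    simp only [mem_preimage, mem_singleton_iff, hb, sub_eq_zero]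
    exact ⟨fun h => mul_left_cancel₀ hs.ne' h, fun h => by rw [h]⟩
  have := nullSingletonClass_gaussianReal (μ := 0) (v := 1) one_ne_zero
  have h := ProbabilityMeasure.tendsto_measure_of_null_frontier_of_tendsto' hA.tendsto
    (E := Iic 0) (by
      rw [frontier_Iic, ProbabilityMeasure.coe_mk, ← hmap,
        Measure.map_apply (by fun_prop) (measurableSet_singleton _), hpre0]
      simp)
  simp only [ProbabilityMeasure.coe_mk] at h
  rw [← hmap, Measure.map_apply (by fun_prop) measurableSet_Iic, hpre] at h
  rw [cdf_eq_real]
  have h' := (ENNReal.tendsto_toReal (measure_ne_top _ _)).comp h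
  refine h'.congr fun n => ?_
  simp only [Function.comp_apply]
  rw [Measure.map_apply_of_aemeasurable (hA.forall_aemeasurable n) measurableSet_Iic]
  rfl

end Limits

/-! ### Importance sampling weights -/

section Densities

variable {d : ℕ} {q g : EuclideanSpace ℝ (Fin d) → ℝ}

theorem IsPDF.integrable (hq : IsPDF q) : Integrable q := by
  by_contra h
  have := integral_undef h
  rw [hq.integral_eq_one] at this
  exact one_ne_zero this

theorem IsPDF.isProbabilityMeasure_law (hq : IsPDF q) : IsProbabilityMeasure (law q) := by
  refine ⟨?_⟩
  rw [law, withDensity_apply _ MeasurableSet.univ, Measure.restrict_univ,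
    ← ofReal_integral_eq_lintegral_ofReal hq.integrable (ae_of_all _ hq.nonneg),
    hq.integral_eq_one, ENNReal.ofReal_one]

/-- No support condition is needed: `q * (g / q)` is `g` or, where `q = 0`, zero. This lets `target
pu / q` serve as a dominating function although `q` may vanish on part of the target's support. -/
theorem IsPDF.integrable_div (hq : IsPDF q) (hg : Measurable g) (hgi : Integrable g) :
    Integrable (fun x => g x / q x) (law q) := by
  rw [law, integrable_withDensity_iff_integrable_smul' hq.measurable.ennreal_ofReal (by simp)]
  refine hgi.mono ?_ (ae_of_all _ fun x => ?_)
  · exact (hq.measurable.ennreal_ofReal.ennreal_toReal.smul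
      (hg.div hq.measurable)).aestronglyMeasurable
  · rw [ENNReal.toReal_ofReal (hq.nonneg x), smul_eq_mul]
    rcases eq_or_ne (q x) 0 with h | h
    · simp [h]
    · rw [mul_div_cancel₀ _ h]

theorem IsPDF.integral_div (hq : IsPDF q) (h0 : ∀ x, q x = 0 → g x = 0) :
    ∫ x, g x / q x ∂(law q) = ∫ x, g x := by
  rw [law, integral_withDensity_eq_integral_toReal_smul hq.measurable.ennreal_ofReal (by simp)]
  congr 1
  funext x
  rw [ENNReal.toReal_ofReal (hq.nonneg x), smul_eq_mul]
  rcases eq_or_ne (q x) 0 with h | h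
  · simp [h, h0 x h]
  · rw [mul_div_cancel₀ _ h]

/-- Pointwise `q (g / q - m)² = (g - m q)² / q`. The extended variance lets the identity hold also
when both sides are infinite. -/
theorem IsPDF.evariance_div (hq : IsPDF q) (hg : Measurable g) (h0 : ∀ x, q x = 0 → g x = 0) :
    evariance (fun x => g x / q x) (law q) = oisVar g q := by
  have hw : Measurable fun x => g x / q x := hg.div hq.measurable
  rw [evariance, hq.integral_div h0, law, lintegral_withDensity_eq_lintegral_mul _
    hq.measurable.ennreal_ofReal (((hw.sub_const _).enorm).pow_const 2), oisVar]
  refine lintegral_congr fun x => ?_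
  rw [Pi.mul_apply]
  rcases eq_or_ne (q x) 0 with h | h
  · simp [h, h0 x h]
  · have hpos : 0 < q x := (hq.nonneg x).lt_of_ne' h
    rw [← ENNReal.ofReal_div_of_pos hpos, ← ofReal_norm, Real.norm_eq_abs,
      ← ENNReal.ofReal_pow (abs_nonneg _), ← ENNReal.ofReal_mul (hq.nonneg x), sq_abs]
    congr 1
    field_simp

theorem IsPDF.memLp_two_div (hq : IsPDF q) (hg : Measurable g)
    (h0 : ∀ x, q x = 0 → g x = 0) (hfin : oisVar g q ≠ ⊤) :
    MemLp (fun x => g x / q x) 2 (law q) := by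
  have := hq.isProbabilityMeasure_law
  have hw : Measurable fun x => g x / q x := hg.div hq.measurable
  rw [← evariance_lt_top_iff_memLp hw.aestronglyMeasurable,
    hq.evariance_div hg h0]
  exact hfin.lt_top

/-- The central limit theorem for importance sampling. -/
theorem IsPDF.tendstoInDistribution_importance_sampling {Ω : Type*} [MeasurableSpace Ω]
    {P : Measure Ω} [IsProbabilityMeasure P] (hq : IsPDF q) (hg : Measurable g)
    (h0 : ∀ x, q x = 0 → g x = 0) (hfin : oisVar g q ≠ ⊤)
    {X : ℕ → Ω → EuclideanSpace ℝ (Fin d)} (hX : ∀ i, HasLaw (X i) (law q) P)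
    (hind : iIndepFun X P) {k : ℕ → ℕ} (hk : Tendsto k atTop atTop) {θ : ℝ} (hθ : 0 < θ)
    (hkθ : Tendsto (fun n => (k n : ℝ) / (n : ℝ)) atTop (𝓝 θ)) :
    TendstoInDistribution
      (fun (n : ℕ) ω => √(n : ℝ) * ((1 / (k n : ℝ)) *
        ∑ i ∈ Finset.range (k n), (g (X i ω) / q (X i ω) - ∫ x, g x)))
      atTop id (fun _ => P) (gaussianReal 0 ((oisVar g q).toReal / θ).toNNReal) := by
  have hw : Measurable fun x => g x / q x := hg.div hq.measurable
  have hmem := hq.memLp_two_div hg h0 hfin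
  have hident : IdentDistrib (fun ω => g (X 0 ω) / q (X 0 ω)) (fun x => g x / q x) P (law q) :=
    ((hX 0).identDistrib HasLaw.id).comp hw
  have h := tendstoInDistribution_sqrt_mul_average_sub (P := P)
    (U := fun i ω => g (X i ω) / q (X i ω)) (hident.memLp_iff.2 hmem)
    (hind.comp (fun _ x => g x / q x) fun _ => hw)
    (fun i => ((hX i).identDistrib (hX 0)).comp hw) hk hθ hkθ
  rw [hident.variance_eq, hident.integral_eq, hq.integral_div h0, variance,
    hq.evariance_div hg h0] at h
  exact h

end Densities

/-! ### The target, its centred parts and the support condition -/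

section Target

variable {d : ℕ} {f pu : EuclideanSpace ℝ (Fin d) → ℝ}

theorem target_nonneg (hpu_nonneg : ∀ x, 0 ≤ pu x) (x : EuclideanSpace ℝ (Fin d)) :
    0 ≤ target pu x :=
  div_nonneg (hpu_nonneg x) (integral_nonneg hpu_nonneg)

theorem measurable_target (hpu : Measurable pu) : Measurable (target pu) :=
  hpu.div_const _

theorem integrable_target (hpu_int : Integrable pu) : Integrable (target pu) :=
  hpu_int.div_const _

theorem integral_target (hc : 0 < normConst pu) : ∫ x, target pu x = 1 := by
  simp only [target]
  rw [integral_div]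
  exact div_self hc.ne'

theorem measurable_posIntegrand (hf : Measurable f) (hpu : Measurable pu) :
    Measurable (posIntegrand f pu) :=
  ((hf.sub_const _).sup_const 0).mul (measurable_target hpu)

theorem measurable_negIntegrand (hf : Measurable f) (hpu : Measurable pu) :
    Measurable (negIntegrand f pu) :=
  ((hf.sub_const _).neg.sup_const 0).mul (measurable_target hpu)

theorem posIntegrand_nonneg (hpu_nonneg : ∀ x, 0 ≤ pu x) (x : EuclideanSpace ℝ (Fin d)) :
    0 ≤ posIntegrand f pu x :=
  mul_nonneg (posPart_nonneg _) (target_nonneg hpu_nonneg x)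

theorem negIntegrand_nonneg (hpu_nonneg : ∀ x, 0 ≤ pu x) (x : EuclideanSpace ℝ (Fin d)) :
    0 ≤ negIntegrand f pu x :=
  mul_nonneg (negPart_nonneg _) (target_nonneg hpu_nonneg x)

theorem integrable_centered (hpu_int : Integrable pu)
    (hmean : Integrable fun x => f x * target pu x) :
    Integrable fun x => (f x - mean f pu) * target pu x := by
  simp_rw [sub_mul]
  exact hmean.sub ((integrable_target hpu_int).const_mul _)

theorem integral_centered (hpu_int : Integrable pu) (hc : 0 < normConst pu)
    (hmean : Integrable fun x => f x * target pu x) :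
    ∫ x, (f x - mean f pu) * target pu x = 0 := by
  simp_rw [sub_mul]
  rw [integral_sub hmean ((integrable_target hpu_int).const_mul _), integral_const_mul,
    integral_target hc, mul_one]
  exact sub_self _

theorem integrable_posIntegrand (hf : Measurable f) (hpu : Measurable pu)
    (hpu_int : Integrable pu)
    (hmean : Integrable fun x => f x * target pu x) : Integrable (posIntegrand f pu) := by
  refine (integrable_centered hpu_int hmean).mono
    (measurable_posIntegrand hf hpu).aestronglyMeasurable (ae_of_all _ fun x => ?_)
  rw [posIntegrand, norm_mul, norm_mul]
  refine mul_le_mul_of_nonneg_right ?_ (norm_nonneg _)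
  rw [Real.norm_eq_abs, Real.norm_eq_abs, abs_of_nonneg (posPart_nonneg _)]
  exact sup_le (le_abs_self _) (abs_nonneg _)

theorem integrable_negIntegrand (hf : Measurable f) (hpu : Measurable pu)
    (hpu_int : Integrable pu)
    (hmean : Integrable fun x => f x * target pu x) : Integrable (negIntegrand f pu) := by
  refine (integrable_centered hpu_int hmean).mono
    (measurable_negIntegrand hf hpu).aestronglyMeasurable (ae_of_all _ fun x => ?_)
  rw [negIntegrand, norm_mul, norm_mul]
  refine mul_le_mul_of_nonneg_right ?_ (norm_nonneg _)
  rw [Real.norm_eq_abs, Real.norm_eq_abs, abs_of_nonneg (negPart_nonneg _)]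
  exact sup_le (neg_le_abs _) (abs_nonneg _)

theorem integral_posIntegrand_eq (hf : Measurable f) (hpu : Measurable pu)
    (hpu_int : Integrable pu) (hc : 0 < normConst pu)
    (hmean : Integrable fun x => f x * target pu x) :
    ∫ x, posIntegrand f pu x = ∫ x, negIntegrand f pu x := by
  rw [← sub_eq_zero, ← integral_sub (integrable_posIntegrand hf hpu hpu_int hmean)
    (integrable_negIntegrand hf hpu hpu_int hmean),
    ← integral_centered hpu_int hc hmean]
  congr 1
  funext x
  rw [posIntegrand, negIntegrand, ← sub_mul, posPart_sub_negPart]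

theorem target_pos_iff (hc : 0 < normConst pu) {x : EuclideanSpace ℝ (Fin d)} :
    0 < target pu x ↔ 0 < pu x := by
  rw [target, div_pos_iff_of_pos_right hc]

variable {qp qm : EuclideanSpace ℝ (Fin d) → ℝ}

/-- The case `f x = mean f pu` is included because the support condition is applied at a `μ`
strictly below the mean. The condition at the mean alone would say nothing there, yet the drift can
charge this set. -/
theorem SupportCondition.target_eq_zero_of_pos (h : SupportCondition f pu qp qm)
    (hpu_nonneg : ∀ x, 0 ≤ pu x) {x : EuclideanSpace ℝ (Fin d)} (hx : mean f pu ≤ f x)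
    (hq : qp x = 0) : target pu x = 0 := by
  obtain ⟨η, hη, h⟩ := h
  by_contra hne
  have hpos : 0 < pu x := (hpu_nonneg x).lt_of_ne' fun h0 => hne (by rw [target, h0, zero_div])
  refine ((h (mean f pu - η / 2) ⟨by linarith, by linarith⟩ x).1 (mul_pos ?_ hpos)).ne' hq
  exact posPart_pos (by linarith)

theorem SupportCondition.target_eq_zero_of_neg (h : SupportCondition f pu qp qm)
    (hpu_nonneg : ∀ x, 0 ≤ pu x) {x : EuclideanSpace ℝ (Fin d)} (hx : f x ≤ mean f pu)
    (hq : qm x = 0) : target pu x = 0 := by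
  obtain ⟨η, hη, h⟩ := h
  by_contra hne
  have hpos : 0 < pu x := (hpu_nonneg x).lt_of_ne' fun h0 => hne (by rw [target, h0, zero_div])
  refine ((h (mean f pu + η / 2) ⟨by linarith, by linarith⟩ x).2 (mul_pos ?_ hpos)).ne' hq
  exact negPart_pos (by linarith)

theorem SupportCondition.posIntegrand_eq_zero (h : SupportCondition f pu qp qm)
    (hpu_nonneg : ∀ x, 0 ≤ pu x) (x : EuclideanSpace ℝ (Fin d)) (hq : qp x = 0) :
    posIntegrand f pu x = 0 := by
  rw [posIntegrand]
  rcases le_total (mean f pu) (f x) with hx | hx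
  · rw [h.target_eq_zero_of_pos hpu_nonneg hx hq, mul_zero]
  · rw [posPart_eq_zero.2 (sub_nonpos.2 hx), zero_mul]

theorem SupportCondition.negIntegrand_eq_zero (h : SupportCondition f pu qp qm)
    (hpu_nonneg : ∀ x, 0 ≤ pu x) (x : EuclideanSpace ℝ (Fin d)) (hq : qm x = 0) :
    negIntegrand f pu x = 0 := by
  rw [negIntegrand]
  rcases le_total (mean f pu) (f x) with hx | hx
  · rw [negPart_eq_zero.2 (sub_nonneg.2 hx), zero_mul]
  · rw [h.target_eq_zero_of_neg hpu_nonneg hx hq, mul_zero]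

end Target

/-! ### Monotonicity and local expansion of the estimating function -/

section EstimatingFunction

variable {d : ℕ} {f pu qp qm : EuclideanSpace ℝ (Fin d) → ℝ}

theorem antitone_sum_posPart {q : EuclideanSpace ℝ (Fin d) → ℝ} (hpu_nonneg : ∀ x, 0 ≤ pu x)
    (hq : ∀ x, 0 ≤ q x) (k : ℕ) (x : ℕ → EuclideanSpace ℝ (Fin d)) :
    Antitone fun μ : ℝ =>
      (1 / (k : ℝ)) * ∑ i ∈ Finset.range k, (f (x i) - μ)⁺ * pu (x i) / q (x i) := by
  intro a b hab
  refine mul_le_mul_of_nonneg_left (Finset.sum_le_sum fun i _ => ?_) (by positivity)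
  refine div_le_div_of_nonneg_right (mul_le_mul_of_nonneg_right ?_ (hpu_nonneg _)) (hq _)
  exact posPart_mono (by linarith)

theorem monotone_sum_negPart {q : EuclideanSpace ℝ (Fin d) → ℝ} (hpu_nonneg : ∀ x, 0 ≤ pu x)
    (hq : ∀ x, 0 ≤ q x) (k : ℕ) (x : ℕ → EuclideanSpace ℝ (Fin d)) :
    Monotone fun μ : ℝ =>
      (1 / (k : ℝ)) * ∑ i ∈ Finset.range k, (f (x i) - μ)⁻ * pu (x i) / q (x i) := by
  intro a b hab
  refine mul_le_mul_of_nonneg_left (Finset.sum_le_sum fun i _ => ?_) (by positivity)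
  refine div_le_div_of_nonneg_right (mul_le_mul_of_nonneg_right ?_ (hpu_nonneg _)) (hq _)
  exact negPart_anti (by linarith)

theorem antitone_psi (hpu_nonneg : ∀ x, 0 ≤ pu x) (hqp : ∀ x, 0 ≤ qp x) (hqm : ∀ x, 0 ≤ qm x)
    (k l : ℕ) (xp xm : ℕ → EuclideanSpace ℝ (Fin d)) : Antitone (psi f pu qp qm k l xp xm) :=
  fun _ _ hab => sub_le_sub (antitone_sum_posPart hpu_nonneg hqp k xp hab)
    (monotone_sum_negPart hpu_nonneg hqm l xm hab)

/-- If `Ψ s ≤ 0` with `s < m`, monotonicity forces `Ψ s = 0`, against uniqueness. -/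
theorem IsUniqueZero.le_iff_of_antitone {Ψ : ℝ → ℝ} {m : ℝ} (h : IsUniqueZero Ψ m)
    (hΨ : Antitone Ψ) (s : ℝ) : m ≤ s ↔ Ψ s ≤ 0 := by
  refine ⟨fun hs => h.1 ▸ hΨ hs, fun hs => ?_⟩
  by_contra! hlt
  exact hlt.ne (h.2 s (le_antisymm hs (h.1 ▸ hΨ hlt.le)))

/-- The increment `(r y)⁺ - (r y - a)⁺` of the positive part. -/
def posIncrement (a r y : ℝ) : ℝ := (r * y)⁺ - (r * y - a)⁺

/-- The limit of `posIncrement a r y` as `r → ∞`. -/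
def posIncrementLim (a y : ℝ) : ℝ := if 0 < y then a else if y = 0 then -a⁻ else 0

/-- The positive part is monotone and 1-Lipschitz, so the increment lies between `0` and `a`; this
gives both this bound and the next, uniformly in `r` and `y`. -/
theorem abs_posIncrement_le (a r y : ℝ) : |posIncrement a r y| ≤ |a| := by
  simp only [posIncrement, posPart_def, abs_le]
  rcases abs_cases a with h | h <;> constructor <;> grind

theorem abs_sub_posIncrement_le (a r y : ℝ) : |a - posIncrement a r y| ≤ |a| := by
  simp only [posIncrement, posPart_def, abs_le]
  rcases abs_cases a with h | h <;> constructor <;> grind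

/-- The increment is eventually constant: for `y ≠ 0`, once `r ≥ 0` and `r ≥ a / y`, the numbers `r
y` and `r y - a` both lie on the side of `0` given by the sign of `y`. -/
theorem tendsto_posIncrement (a y : ℝ) :
    Tendsto (fun r => posIncrement a r y) atTop (𝓝 (posIncrementLim a y)) := by
  refine tendsto_const_nhds.congr' ?_
  rcases lt_trichotomy y 0 with h | h | h
  · filter_upwards [eventually_ge_atTop 0, eventually_ge_atTop (a / y)] with r h0 hr
    have h1 : r * y ≤ a := (div_le_iff_of_neg h).1 hr
    have h2 : r * y ≤ 0 := mul_nonpos_of_nonneg_of_nonpos h0 h.le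
    rw [posIncrementLim, if_neg h.not_gt, if_neg h.ne, posIncrement, posPart_eq_zero.2 h2,
      posPart_eq_zero.2 (sub_nonpos.2 h1), sub_zero]
  · refine Eventually.of_forall fun r => ?_
    simp [posIncrementLim, posIncrement, h]
  · filter_upwards [eventually_ge_atTop 0, eventually_ge_atTop (a / y)] with r h0 hr
    have h1 : a ≤ r * y := (div_le_iff₀ h).1 hr
    have h2 : 0 ≤ r * y := mul_nonneg h0 h.le
    rw [posIncrementLim, if_pos h, posIncrement, posPart_eq_self.2 h2,
      posPart_eq_self.2 (sub_nonneg.2 h1)]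
    ring

theorem measurable_posIncrement (a r : ℝ) : Measurable (posIncrement a r) := by
  unfold posIncrement
  exact ((measurable_const_mul r).sup_const 0).sub
    (((measurable_const_mul r).sub_const a).sup_const 0)

theorem measurable_posIncrementLim (a : ℝ) : Measurable (posIncrementLim a) :=
  Measurable.ite measurableSet_Ioi measurable_const
    (Measurable.ite (measurableSet_singleton 0) measurable_const measurable_const)

theorem sqrt_mul_posPart_sub {r : ℝ} (hr : 0 < r) (a z μ : ℝ) :
    r * (z - (μ + a / r))⁺ = r * (z - μ)⁺ - posIncrement a r (z - μ) := by
  have h : ∀ u : ℝ, r * u⁺ = (r * u)⁺ := fun u => by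
    rw [posPart_def, posPart_def, mul_max_of_nonneg _ _ hr.le, mul_zero]
  rw [posIncrement, h, h, sub_sub_cancel]
  congr 1
  field_simp
  ring

theorem sqrt_mul_negPart_sub {r : ℝ} (hr : 0 < r) (a z μ : ℝ) :
    r * (z - (μ + a / r))⁻ = r * (z - μ)⁻ + (a - posIncrement a r (z - μ)) := by
  have h : ∀ u : ℝ, u⁻ = u⁺ - u := fun u => by linarith [posPart_sub_negPart u]
  rw [h, h, mul_sub, sqrt_mul_posPart_sub hr]
  field_simp
  ring

/-- The expansion of the estimating function around the estimand. -/
theorem sqrt_mul_psi_eq (hc : 0 < normConst pu) {r : ℝ} (hr : 0 < r) (a m : ℝ) {k l : ℕ}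
    (hk : k ≠ 0) (hl : l ≠ 0) (xp xm : ℕ → EuclideanSpace ℝ (Fin d)) :
    r * psi f pu qp qm k l xp xm (mean f pu + a / r) / normConst pu
      = r * ((1 / (k : ℝ)) * ∑ i ∈ Finset.range k, (posIntegrand f pu (xp i) / qp (xp i) - m))
        + -1 * (r * ((1 / (l : ℝ)) *
          ∑ i ∈ Finset.range l, (negIntegrand f pu (xm i) / qm (xm i) - m)))
        + -((1 / (k : ℝ)) * ∑ i ∈ Finset.range k,
          posIncrement a r (f (xp i) - mean f pu) * target pu (xp i) / qp (xp i))
        + -((1 / (l : ℝ)) * ∑ i ∈ Finset.range l,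
          (a - posIncrement a r (f (xm i) - mean f pu)) * target pu (xm i) / qm (xm i)) := by
  have hp : ∀ x, r * ((f x - (mean f pu + a / r))⁺ * pu x / qp x) / normConst pu
      = r * (posIntegrand f pu x / qp x)
        - posIncrement a r (f x - mean f pu) * target pu x / qp x := fun x => by
    have h : r * ((f x - (mean f pu + a / r))⁺ * pu x / qp x) / normConst pu
        = r * (f x - (mean f pu + a / r))⁺ * pu x / qp x / normConst pu := by ring
    rw [h, sqrt_mul_posPart_sub hr, posIntegrand, target]
    ring
  have hm : ∀ x, r * ((f x - (mean f pu + a / r))⁻ * pu x / qm x) / normConst pu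
      = r * (negIntegrand f pu x / qm x)
        + (a - posIncrement a r (f x - mean f pu)) * target pu x / qm x := fun x => by
    have h : r * ((f x - (mean f pu + a / r))⁻ * pu x / qm x) / normConst pu
        = r * (f x - (mean f pu + a / r))⁻ * pu x / qm x / normConst pu := by ring
    rw [h, sqrt_mul_negPart_sub hr, negIntegrand, target]
    ring
  have hsp : r * ∑ i ∈ Finset.range k,
      (f (xp i) - (mean f pu + a / r))⁺ * pu (xp i) / qp (xp i) =
      normConst pu * (r * ∑ i ∈ Finset.range k, posIntegrand f pu (xp i) / qp (xp i)
        - ∑ i ∈ Finset.range k,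
          posIncrement a r (f (xp i) - mean f pu) * target pu (xp i) / qp (xp i)) := by
    rw [Finset.mul_sum, Finset.mul_sum, ← Finset.sum_sub_distrib, Finset.mul_sum]
    exact Finset.sum_congr rfl fun i _ => by rw [← hp, mul_div_cancel₀ _ hc.ne']
  have hsm : r * ∑ i ∈ Finset.range l,
      (f (xm i) - (mean f pu + a / r))⁻ * pu (xm i) / qm (xm i) =
      normConst pu * (r * ∑ i ∈ Finset.range l, negIntegrand f pu (xm i) / qm (xm i)
        + ∑ i ∈ Finset.range l,
          (a - posIncrement a r (f (xm i) - mean f pu)) * target pu (xm i) / qm (xm i)) := by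
    rw [Finset.mul_sum, Finset.mul_sum, ← Finset.sum_add_distrib, Finset.mul_sum]
    exact Finset.sum_congr rfl fun i _ => by rw [← hm, mul_div_cancel₀ _ hc.ne']
  have hk' : (k : ℝ) ≠ 0 := Nat.cast_ne_zero.2 hk
  have hl' : (l : ℝ) ≠ 0 := Nat.cast_ne_zero.2 hl
  rw [psi, mul_sub, mul_left_comm r, mul_left_comm r, hsp, hsm, Finset.sum_sub_distrib,
    Finset.sum_sub_distrib, Finset.sum_const, Finset.sum_const, Finset.card_range,
    Finset.card_range, nsmul_eq_mul, nsmul_eq_mul]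
  field_simp
  ring

end EstimatingFunction

/-! ### The central limit theorem for the zero -/

section CentralLimit

variable {d : ℕ} {f pu qp qm : EuclideanSpace ℝ (Fin d) → ℝ}
  {Ω : Type*} [MeasurableSpace Ω] {P : Measure Ω}
  {Xp Xm : ℕ → Ω → EuclideanSpace ℝ (Fin d)}

/-- Convergence in distribution of the estimating function at `μ₀ + a / √n`. -/
theorem tendstoInDistribution_sqrt_mul_psi [IsProbabilityMeasure P]
    (hf : Measurable f) (hpu : Measurable pu) (hpu_nonneg : ∀ x, 0 ≤ pu x)
    (hpu_int : Integrable pu) (hc : 0 < normConst pu)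
    (hmean : Integrable fun x => f x * target pu x)
    {np nm : ℕ → ℕ} (hmin : Tendsto (fun n => min (np n) (nm n)) atTop atTop)
    {θ : ℝ} (hθ : θ ∈ Ioo (0 : ℝ) 1)
    (hθp : Tendsto (fun n => (np n : ℝ) / (n : ℝ)) atTop (𝓝 θ))
    (hθm : Tendsto (fun n => (nm n : ℝ) / (n : ℝ)) atTop (𝓝 (1 - θ)))
    (hqp : IsPDF qp) (hqm : IsPDF qm) (hsupp : SupportCondition f pu qp qm)
    (hvp : oisVar (posIntegrand f pu) qp ≠ ⊤) (hvm : oisVar (negIntegrand f pu) qm ≠ ⊤)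
    (hX : IsSample P qp qm Xp Xm) (a : ℝ) :
    ∃ Y : ℕ → Ω → ℝ,
      TendstoInDistribution Y atTop (fun x => x - a) (fun _ => P)
        (gaussianReal 0 (asympVar f pu qp qm θ).toNNReal) ∧
      ∀ᶠ n : ℕ in atTop, ∀ ω, Y n ω = √(n : ℝ) * psi f pu qp qm (np n) (nm n)
        (fun i => Xp i ω) (fun i => Xm i ω) (mean f pu + a / √(n : ℝ)) / normConst pu := by
  have hnp : Tendsto np atTop atTop := tendsto_atTop_mono (fun n => min_le_left _ _) hmin
  have hnm : Tendsto nm atTop atTop := tendsto_atTop_mono (fun n => min_le_right _ _) hmin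
  have hθ' : 0 < 1 - θ := sub_pos.2 hθ.2
  have hsqrt : Tendsto (fun n : ℕ => √(n : ℝ)) atTop atTop :=
    Real.tendsto_sqrt_atTop.comp tendsto_natCast_atTop_atTop
  have hgp := measurable_posIntegrand hf hpu
  have hgm := measurable_negIntegrand hf hpu
  have htar := measurable_target hpu
  have htar_int := integrable_target hpu_int
  have htar_nonneg := target_nonneg hpu_nonneg
  have hy : Measurable fun x => f x - mean f pu := hf.sub_const _
  -- the Gaussian part
  have hTp := hqp.tendstoInDistribution_importance_sampling hgp
    (hsupp.posIntegrand_eq_zero hpu_nonneg) hvp hX.law_pos hX.indep_pos hnp hθ.1 hθp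
  have hTm := hqm.tendstoInDistribution_importance_sampling hgm
    (hsupp.negIntegrand_eq_zero hpu_nonneg) hvm hX.law_neg hX.indep_neg hnm hθ' hθm
  have hTm' := tendstoInDistribution_const_mul_gaussianReal hTm
    (tendsto_const_nhds (x := (-1 : ℝ)))
  -- Both averages must be centred at the same `m`, so that it cancels in `psi`.
  rw [← integral_posIntegrand_eq hf hpu hpu_int hc hmean] at hTm'
  set m := ∫ x, posIntegrand f pu x
  have hT := tendstoInDistribution_add_gaussianReal hTp hTm' fun n => by
    have hp : Measurable fun x : ℕ → EuclideanSpace ℝ (Fin d) => √(n : ℝ) * ((1 / (np n : ℝ)) *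
        ∑ i ∈ Finset.range (np n), (posIntegrand f pu (x i) / qp (x i) - m)) :=
      ((Finset.measurable_fun_sum _ fun i _ => ((hgp.div hqp.measurable).comp
        (measurable_pi_apply i)).sub_const m).const_mul _).const_mul _
    have hm : Measurable fun x : ℕ → EuclideanSpace ℝ (Fin d) =>
        -1 * (√(n : ℝ) * ((1 / (nm n : ℝ)) *
        ∑ i ∈ Finset.range (nm n), (negIntegrand f pu (x i) / qm (x i) - m))) :=
      (((Finset.measurable_fun_sum _ fun i _ => ((hgm.div hqm.measurable).comp
        (measurable_pi_apply i)).sub_const m).const_mul _).const_mul _).const_mul _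
    exact hX.indep.comp hp hm
  have hvar : ((oisVar (posIntegrand f pu) qp).toReal / θ).toNNReal
      + NNReal.mk ((-1) ^ 2) (sq_nonneg _) *
        ((oisVar (negIntegrand f pu) qm).toReal / (1 - θ)).toNNReal
      = (asympVar f pu qp qm θ).toNNReal := by
    have h1 : NNReal.mk ((-1 : ℝ) ^ 2) (sq_nonneg _) = 1 := by ext; norm_num
    rw [h1, one_mul, asympVar, Real.toNNReal_add (div_nonneg ENNReal.toReal_nonneg hθ.1.le)
      (div_nonneg ENNReal.toReal_nonneg hθ'.le)]
  rw [hvar] at hT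
  -- the drift
  have hdrift : ∀ {q : EuclideanSpace ℝ (Fin d) → ℝ} {X : ℕ → Ω → EuclideanSpace ℝ (Fin d)}
      {k : ℕ → ℕ} {G : ℕ → ℝ → ℝ} {G₀ : ℝ → ℝ}, IsPDF q → (∀ i, HasLaw (X i) (law q) P) →
      iIndepFun X P → Tendsto k atTop atTop → (∀ n, Measurable (G n)) → Measurable G₀ →
      (∀ n y, |G n y| ≤ |a|) → (∀ y, Tendsto (fun n => G n y) atTop (𝓝 (G₀ y))) →
      (∀ x, q x = 0 → G₀ (f x - mean f pu) * target pu x = 0) →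
      (∀ n, AEMeasurable (fun ω => -((1 / (k n : ℝ)) * ∑ i ∈ Finset.range (k n),
        G n (f (X i ω) - mean f pu) * target pu (X i ω) / q (X i ω))) P) ∧
      TendstoInMeasure P (fun n ω => -((1 / (k n : ℝ)) * ∑ i ∈ Finset.range (k n),
        G n (f (X i ω) - mean f pu) * target pu (X i ω) / q (X i ω))) atTop
        (fun _ => -∫ x, G₀ (f x - mean f pu) * target pu x) := by
    intro q X k G G₀ hq hXl hXi hk hG hG₀ hbd hlim h0
    have hφ : ∀ n, Measurable fun x => G n (f x - mean f pu) * target pu x / q x := fun n =>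
      (((hG n).comp hy).mul htar).div hq.measurable
    refine ⟨fun n => ((Finset.aemeasurable_fun_sum _ fun i _ =>
      (hφ n).comp_aemeasurable (hXl i).aemeasurable).const_mul _).neg, ?_⟩
    have h := tendstoInMeasure_average_of_dominated hXl hXi hφ
      (φ₀ := fun x => G₀ (f x - mean f pu) * target pu x / q x)
      (((hG₀.comp hy).mul htar).div hq.measurable)
      ((hq.integrable_div htar htar_int).const_mul |a|) (fun n x => ?_) (fun x => ?_) hk
    · rw [hq.integral_div h0] at h
      intro ε hε
      refine (h ε hε).congr fun n => ?_
      simp only [edist_neg_neg]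
    · rw [abs_div, abs_mul, abs_of_nonneg (htar_nonneg x), abs_of_nonneg (hq.nonneg x),
        mul_div_assoc]
      exact mul_le_mul_of_nonneg_right (hbd n _) (div_nonneg (htar_nonneg x) (hq.nonneg x))
    · exact ((hlim _).mul_const _).div_const _
  have hlim : ∀ y, Tendsto (fun n : ℕ => posIncrement a (√(n : ℝ)) y) atTop
      (𝓝 (posIncrementLim a y)) := fun y => (tendsto_posIncrement a y).comp hsqrt
  have hA := hdrift (G := fun n => posIncrement a (√(n : ℝ))) hqp hX.law_pos hX.indep_pos hnp
    (fun n => measurable_posIncrement _ _) (measurable_posIncrementLim a)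
    (fun n y => abs_posIncrement_le _ _ _) hlim (fun x hx => by
      -- Where `qp` vanishes, either the target does too, or `f` is below the mean and the limiting
      -- increment is `0`.
      rcases le_or_gt (mean f pu) (f x) with h | h
      · rw [hsupp.target_eq_zero_of_pos hpu_nonneg h hx, mul_zero]
      · rw [posIncrementLim, if_neg (by linarith), if_neg (by linarith), zero_mul])
  have hB := hdrift (G := fun n y => a - posIncrement a (√(n : ℝ)) y) hqm hX.law_neg hX.indep_neg
    hnm (fun n => (measurable_posIncrement _ _).const_sub a)
    ((measurable_posIncrementLim a).const_sub a)
    (fun n y => abs_sub_posIncrement_le _ _ _) (fun y => (hlim y).const_sub a) (fun x hx => by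
      rcases le_or_gt (f x) (mean f pu) with h | h
      · rw [hsupp.target_eq_zero_of_neg hpu_nonneg h hx, mul_zero]
      · rw [posIncrementLim, if_pos (by linarith), sub_self, zero_mul])
  have hAB := (hT.add_of_tendstoInMeasure_const hA.2 hA.1).add_of_tendstoInMeasure_const hB.2 hB.1
  -- Each drift depends on the mass of `{f = μ₀}`, but the two integrands add up to `a * target pu`.
  have hsum : (∫ x, posIncrementLim a (f x - mean f pu) * target pu x)
      + ∫ x, (a - posIncrementLim a (f x - mean f pu)) * target pu x = a := by
    have hi : Integrable fun x => posIncrementLim a (f x - mean f pu) * target pu x := by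
      refine (htar_int.const_mul |a|).mono' (((measurable_posIncrementLim a).comp
        hy).mul htar).aestronglyMeasurable (ae_of_all _ fun x => ?_)
      rw [norm_mul, Real.norm_eq_abs, Real.norm_eq_abs, abs_of_nonneg (htar_nonneg x)]
      exact mul_le_mul_of_nonneg_right
        (le_of_tendsto' (hlim _).abs fun n => abs_posIncrement_le _ _ _) (htar_nonneg x)
    simp_rw [sub_mul]
    rw [integral_sub (htar_int.const_mul a) hi, integral_const_mul, integral_target hc]
    ring
  have hshift : (fun x : ℝ => id x
      + -(∫ x, posIncrementLim a (f x - mean f pu) * target pu x)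
      + -∫ x, (a - posIncrementLim a (f x - mean f pu)) * target pu x) = fun x => x - a := by
    funext x
    rw [id]
    linarith
  rw [hshift] at hAB
  refine ⟨_, hAB, ?_⟩
  filter_upwards [hnp.eventually_ge_atTop 1, hnm.eventually_ge_atTop 1, eventually_ge_atTop 1]
    with n h1 h2 h3 ω
  rw [sqrt_mul_psi_eq hc (Real.sqrt_pos.2 (by exact_mod_cast h3)) a m (by omega) (by omega)]
  rfl

/-- The central limit theorem for the unique zero of the estimating function. -/
theorem tendsto_measureReal_estimator_le [IsProbabilityMeasure P]
    (hf : Measurable f) (hpu : Measurable pu) (hpu_nonneg : ∀ x, 0 ≤ pu x)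
    (hpu_int : Integrable pu) (hc : 0 < normConst pu)
    (hmean : Integrable fun x => f x * target pu x)
    {np nm : ℕ → ℕ} (hmin : Tendsto (fun n => min (np n) (nm n)) atTop atTop)
    {θ : ℝ} (hθ : θ ∈ Ioo (0 : ℝ) 1)
    (hθp : Tendsto (fun n => (np n : ℝ) / (n : ℝ)) atTop (𝓝 θ))
    (hθm : Tendsto (fun n => (nm n : ℝ) / (n : ℝ)) atTop (𝓝 (1 - θ)))
    (hqp : IsPDF qp) (hqm : IsPDF qm) (hsupp : SupportCondition f pu qp qm)
    (hvp : oisVar (posIntegrand f pu) qp ≠ ⊤) (hvm : oisVar (negIntegrand f pu) qm ≠ ⊤)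
    (hσ : 0 < asympVar f pu qp qm θ) (hX : IsSample P qp qm Xp Xm) {μhat : ℕ → Ω → ℝ}
    (hzero : Tendsto (fun n => P {ω | ¬ IsUniqueZero
      (psi f pu qp qm (np n) (nm n) (fun i => Xp i ω) (fun i => Xm i ω)) (μhat n ω)})
      atTop (𝓝 0)) (t : ℝ) :
    Tendsto (fun n : ℕ => P.real {ω |
        √(n : ℝ) * (μhat n ω - mean f pu) / √(asympVar f pu qp qm θ) ≤ t})
      atTop (𝓝 (cdf (gaussianReal 0 1) t)) := by
  set σ := √(asympVar f pu qp qm θ)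
  have hσpos : 0 < σ := Real.sqrt_pos.2 hσ
  obtain ⟨Y, hY, hYeq⟩ := tendstoInDistribution_sqrt_mul_psi hf hpu hpu_nonneg hpu_int hc hmean
    hmin hθ hθp hθm hqp hqm hsupp hvp hvm hX (σ * t)
  rw [← Real.sq_sqrt hσ.le] at hY
  have hlim := tendsto_measureReal_nonpos hσpos rfl hY
  have hbad : Tendsto (fun n => P.real {ω | ¬ IsUniqueZero
      (psi f pu qp qm (np n) (nm n) (fun i => Xp i ω) (fun i => Xm i ω)) (μhat n ω)})
      atTop (𝓝 0) := by
    exact (ENNReal.tendsto_toReal ENNReal.zero_ne_top).comp hzero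
  have hiff : ∀ᶠ n : ℕ in atTop, ∀ ω, IsUniqueZero
      (psi f pu qp qm (np n) (nm n) (fun i => Xp i ω) (fun i => Xm i ω)) (μhat n ω) →
      (√(n : ℝ) * (μhat n ω - mean f pu) / σ ≤ t ↔ Y n ω ≤ 0) := by
    filter_upwards [hYeq, eventually_ge_atTop 1] with n hn h1 ω hω
    have hr : 0 < √(n : ℝ) := Real.sqrt_pos.2 (by exact_mod_cast h1)
    have h := hω.le_iff_of_antitone (antitone_psi hpu_nonneg hqp.nonneg hqm.nonneg _ _ _ _)
      (mean f pu + σ * t / √(n : ℝ))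
    have hsign : ∀ z : ℝ, √(n : ℝ) * z ≤ 0 ↔ z ≤ 0 := fun z =>
      ⟨fun hz => nonpos_of_mul_nonpos_right hz hr, mul_nonpos_of_nonneg_of_nonpos hr.le⟩
    rw [hn ω, div_le_iff₀ hσpos, div_le_iff₀ hc, zero_mul, hsign, ← h,
      ← sub_le_iff_le_add', le_div_iff₀ hr, mul_comm, mul_comm t]
  -- The two events agree off the bad event, so their probabilities differ by at most its
  -- probability. Only monotonicity and subadditivity enter, so `μhat` need not be measurable.
  refine tendsto_of_tendsto_of_tendsto_of_le_of_le' (by simpa using hlim.sub hbad)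
    (by simpa using hlim.add hbad) ?_ ?_
  · filter_upwards [hiff] with n hn
    rw [sub_le_iff_le_add]
    refine (measureReal_mono fun ω hω => ?_).trans (measureReal_union_le _ _)
    by_cases h : IsUniqueZero
      (psi f pu qp qm (np n) (nm n) (fun i => Xp i ω) (fun i => Xm i ω)) (μhat n ω)
    · exact Or.inl ((hn ω h).2 hω)
    · exact Or.inr h
  · filter_upwards [hiff] with n hn
    refine (measureReal_mono fun ω hω => ?_).trans (measureReal_union_le _ _)
    by_cases h : IsUniqueZero
      (psi f pu qp qm (np n) (nm n) (fun i => Xp i ω) (fun i => Xm i ω)) (μhat n ω)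
    · exact Or.inl ((hn ω h).1 hω)
    · exact Or.inr h

end CentralLimit

/-! ### Defensive mixtures -/

section Mixture

variable {d : ℕ} {g p : EuclideanSpace ℝ (Fin d) → ℝ}

/-- The defensive mixture `(1 - δ) g / ∫ g + δ p`. -/
def defensiveMixture (g p : EuclideanSpace ℝ (Fin d) → ℝ) (δ : ℝ)
    (x : EuclideanSpace ℝ (Fin d)) : ℝ :=
  (1 - δ) * normalized g x + δ * p x

theorem normalized_nonneg (hg0 : ∀ x, 0 ≤ g x) (x : EuclideanSpace ℝ (Fin d)) :
    0 ≤ normalized g x :=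
  div_nonneg (hg0 x) (integral_nonneg hg0)

theorem isPDF_normalized (hg : Measurable g) (hg0 : ∀ x, 0 ≤ g x) (hm : 0 < ∫ x, g x) :
    IsPDF (normalized g) where
  measurable := hg.div_const _
  nonneg := normalized_nonneg hg0
  integral_eq_one := by
    simp only [normalized]
    rw [integral_div, div_self hm.ne']

variable {δ : ℝ}

theorem isPDF_defensiveMixture (hg : Measurable g) (hg0 : ∀ x, 0 ≤ g x) (hm : 0 < ∫ x, g x)
    (hp : IsPDF p) (hδ : 0 ≤ δ) (hδ1 : δ ≤ 1) : IsPDF (defensiveMixture g p δ) where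
  measurable := ((isPDF_normalized hg hg0 hm).measurable.const_mul _).add
    (hp.measurable.const_mul _)
  nonneg x := add_nonneg (mul_nonneg (sub_nonneg.2 hδ1) (normalized_nonneg hg0 x))
    (mul_nonneg hδ (hp.nonneg x))
  integral_eq_one := by
    have hr := isPDF_normalized hg hg0 hm
    simp only [defensiveMixture]
    rw [integral_add (hr.integrable.const_mul _) (hp.integrable.const_mul _), integral_const_mul,
      integral_const_mul, hr.integral_eq_one, hp.integral_eq_one]
    ring

theorem defensiveMixture_pos (hg0 : ∀ x, 0 ≤ g x) (hδ : 0 < δ) (hδ1 : δ ≤ 1)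
    {x : EuclideanSpace ℝ (Fin d)} (hx : 0 < p x) : 0 < defensiveMixture g p δ x :=
  add_pos_of_nonneg_of_pos (mul_nonneg (sub_nonneg.2 hδ1) (normalized_nonneg hg0 x))
    (mul_pos hδ hx)

theorem integral_abs_defensiveMixture_sub_le (hg : Measurable g) (hg0 : ∀ x, 0 ≤ g x)
    (hm : 0 < ∫ x, g x) (hp : IsPDF p) (hδ : 0 ≤ δ) :
    ∫ x, |defensiveMixture g p δ x - normalized g x| ≤ 2 * δ := by
  have hr := isPDF_normalized hg hg0 hm
  have h : ∀ x, |defensiveMixture g p δ x - normalized g x|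
      ≤ δ * p x + δ * normalized g x := fun x => by
    have : defensiveMixture g p δ x - normalized g x = δ * (p x - normalized g x) := by
      rw [defensiveMixture]
      ring
    rw [this, abs_mul, abs_of_nonneg hδ, ← mul_add]
    refine mul_le_mul_of_nonneg_left ((abs_sub _ _).trans ?_) hδ
    rw [abs_of_nonneg (hp.nonneg x), abs_of_nonneg (hr.nonneg x)]
  refine (integral_mono_of_nonneg (ae_of_all _ fun x => abs_nonneg _)
    ((hp.integrable.const_mul δ).add (hr.integrable.const_mul δ)) (ae_of_all _ h)).trans
    (le_of_eq ?_)
  simp only [Pi.add_apply]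
  rw [integral_add (hp.integrable.const_mul _) (hr.integrable.const_mul _), integral_const_mul,
    integral_const_mul, hr.integral_eq_one, hp.integral_eq_one]
  ring

theorem sub_mul_defensiveMixture (hm : 0 < ∫ x, g x) (x : EuclideanSpace ℝ (Fin d)) :
    g x - (∫ y, g y) * defensiveMixture g p δ x
      = (∫ y, g y) * δ * (normalized g x - p x) := by
  have : g x = (∫ y, g y) * normalized g x := by rw [normalized, mul_div_cancel₀ _ hm.ne']
  rw [defensiveMixture]
  linear_combination this

/-- Write `r = g / m` and `q` for the mixture. Then `g - m q = m δ (r - p)`, and `δ ≤ 1 / 2` gives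
`q ≥ δ (r + p)`, hence `δ (r - p)² ≤ (r + p) q`. The integrand is at most `m² δ (r + p)`, of
integral `2 m² δ`. -/
theorem oisVar_defensiveMixture_le (hg : Measurable g) (hg0 : ∀ x, 0 ≤ g x)
    (hm : 0 < ∫ x, g x) (hp : IsPDF p) (hδ : 0 < δ) (hδ1 : δ ≤ 1 / 2) :
    oisVar g (defensiveMixture g p δ) ≤ ENNReal.ofReal (2 * (∫ x, g x) ^ 2 * δ) := by
  set m := ∫ x, g x with hmdef
  have hr := isPDF_normalized hg hg0 hm
  have hpt : ∀ x, ENNReal.ofReal ((g x - m * defensiveMixture g p δ x) ^ 2)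
        / ENNReal.ofReal (defensiveMixture g p δ x)
      ≤ ENNReal.ofReal (m ^ 2 * δ * (normalized g x + p x)) := fun x => by
    have hr0 := hr.nonneg x
    have hp0 := hp.nonneg x
    refine ENNReal.div_le_of_le_mul ?_
    rw [← ENNReal.ofReal_mul (by positivity)]
    refine ENNReal.ofReal_le_ofReal ?_
    rw [hmdef, sub_mul_defensiveMixture hm, ← hmdef, defensiveMixture]
    have key : δ * (normalized g x - p x) ^ 2
        ≤ (normalized g x + p x) * ((1 - δ) * normalized g x + δ * p x) := by
      nlinarith [mul_nonneg hr0 hp0, mul_nonneg hδ.le (mul_nonneg hr0 hp0),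
        mul_nonneg (sub_nonneg.2 hδ1) (mul_nonneg hr0 hr0)]
    calc (m * δ * (normalized g x - p x)) ^ 2
        = m ^ 2 * δ * (δ * (normalized g x - p x) ^ 2) := by ring
      _ ≤ m ^ 2 * δ * ((normalized g x + p x) * ((1 - δ) * normalized g x + δ * p x)) :=
        mul_le_mul_of_nonneg_left key (by positivity)
      _ = _ := by ring
  refine (lintegral_mono hpt).trans (le_of_eq ?_)
  have hint : Integrable fun x => m ^ 2 * δ * (normalized g x + p x) :=
    (hr.integrable.add hp.integrable).const_mul _
  rw [← ofReal_integral_eq_lintegral_ofReal hint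
    (ae_of_all _ fun x => mul_nonneg (by positivity) (add_nonneg (hr.nonneg x) (hp.nonneg x)))]
  rw [integral_const_mul, integral_add hr.integrable hp.integrable, hr.integral_eq_one,
    hp.integral_eq_one]
  congr 1
  ring

theorem ae_eq_of_oisVar_defensiveMixture_eq_zero (hg : Measurable g) (hg0 : ∀ x, 0 ≤ g x)
    (hm : 0 < ∫ x, g x) (hp : IsPDF p) (hδ : 0 < δ) (hδ1 : δ ≤ 1)
    (h : oisVar g (defensiveMixture g p δ) = 0) : ∀ᵐ x, g x = (∫ y, g y) * p x := by
  have hq := isPDF_defensiveMixture hg hg0 hm hp hδ.le hδ1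
  rw [oisVar, lintegral_eq_zero_iff] at h
  · filter_upwards [h] with x hx
    rw [Pi.zero_apply, ENNReal.div_eq_zero_iff, or_iff_left ENNReal.ofReal_ne_top,
      ENNReal.ofReal_eq_zero, sub_mul_defensiveMixture hm] at hx
    have h1 := pow_eq_zero_iff (two_ne_zero) |>.1 (le_antisymm hx (sq_nonneg _))
    have h2 := (mul_eq_zero.1 h1).resolve_left (mul_pos hm hδ).ne'
    rw [← sub_eq_zero.1 h2, normalized, mul_div_cancel₀ _ hm.ne']
  · exact ((hg.sub (hq.measurable.const_mul _)).pow_const 2).ennreal_ofReal.div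
      hq.measurable.ennreal_ofReal

end Mixture

/-! ### Existence and uniqueness of the zero -/

section Uniqueness

variable {d : ℕ} {f pu qp qm : EuclideanSpace ℝ (Fin d) → ℝ}

theorem sum_posPart_lt {q : EuclideanSpace ℝ (Fin d) → ℝ} (hpu_nonneg : ∀ x, 0 ≤ pu x)
    (hq : ∀ x, 0 ≤ q x) {k i : ℕ} (hi : i < k) {x : ℕ → EuclideanSpace ℝ (Fin d)} {a b : ℝ}
    (hab : a < b) (ha : a < f (x i)) (hp : 0 < pu (x i)) (hqi : 0 < q (x i)) :
    (1 / (k : ℝ)) * ∑ i ∈ Finset.range k, (f (x i) - b)⁺ * pu (x i) / q (x i)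
      < (1 / (k : ℝ)) * ∑ i ∈ Finset.range k, (f (x i) - a)⁺ * pu (x i) / q (x i) := by
  have hk : (0 : ℝ) < k := by exact_mod_cast (Nat.zero_le i).trans_lt hi
  refine mul_lt_mul_of_pos_left (Finset.sum_lt_sum (fun j _ => ?_)
    ⟨i, Finset.mem_range.2 hi, ?_⟩) (by positivity)
  · refine div_le_div_of_nonneg_right (mul_le_mul_of_nonneg_right ?_ (hpu_nonneg _)) (hq _)
    exact posPart_mono (by linarith)
  · refine div_lt_div_of_pos_right (mul_lt_mul_of_pos_right ?_ hp) hqi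
    rw [posPart_def, posPart_def]
    exact max_lt ((sub_lt_sub_left hab _).trans_le le_sup_left)
      ((sub_pos.2 ha).trans_le le_sup_left)

theorem sum_negPart_lt {q : EuclideanSpace ℝ (Fin d) → ℝ} (hpu_nonneg : ∀ x, 0 ≤ pu x)
    (hq : ∀ x, 0 ≤ q x) {k i : ℕ} (hi : i < k) {x : ℕ → EuclideanSpace ℝ (Fin d)} {a b : ℝ}
    (hab : a < b) (hb : f (x i) < b) (hp : 0 < pu (x i)) (hqi : 0 < q (x i)) :
    (1 / (k : ℝ)) * ∑ i ∈ Finset.range k, (f (x i) - a)⁻ * pu (x i) / q (x i)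
      < (1 / (k : ℝ)) * ∑ i ∈ Finset.range k, (f (x i) - b)⁻ * pu (x i) / q (x i) := by
  have hk : (0 : ℝ) < k := by exact_mod_cast (Nat.zero_le i).trans_lt hi
  refine mul_lt_mul_of_pos_left (Finset.sum_lt_sum (fun j _ => ?_)
    ⟨i, Finset.mem_range.2 hi, ?_⟩) (by positivity)
  · refine div_le_div_of_nonneg_right (mul_le_mul_of_nonneg_right ?_ (hpu_nonneg _)) (hq _)
    exact negPart_anti (by linarith)
  · refine div_lt_div_of_pos_right (mul_lt_mul_of_pos_right ?_ hp) hqi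
    rw [negPart_def, negPart_def]
    exact max_lt ((neg_lt_neg (sub_lt_sub_left hab _)).trans_le le_sup_left)
      ((neg_pos.2 (sub_neg.2 hb)).trans_le le_sup_left)

theorem continuous_psi (k l : ℕ) (xp xm : ℕ → EuclideanSpace ℝ (Fin d)) :
    Continuous (psi f pu qp qm k l xp xm) := by
  unfold psi
  simp only [posPart_def, negPart_def]
  fun_prop

/-- Intermediate value theorem: above all sampled values of `f` the positive sum vanishes, and below
them all the negative sum does. -/
theorem exists_psi_eq_zero (hpu_nonneg : ∀ x, 0 ≤ pu x) (hqp : ∀ x, 0 ≤ qp x)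
    (hqm : ∀ x, 0 ≤ qm x) (k l : ℕ) (xp xm : ℕ → EuclideanSpace ℝ (Fin d)) :
    ∃ m, psi f pu qp qm k l xp xm m = 0 := by
  have hnonneg : ∀ {q : EuclideanSpace ℝ (Fin d) → ℝ}, (∀ x, 0 ≤ q x) → ∀ (k : ℕ)
      (x : ℕ → EuclideanSpace ℝ (Fin d)) (u : ℕ → ℝ), (∀ i, 0 ≤ u i) →
      0 ≤ (1 / (k : ℝ)) * ∑ i ∈ Finset.range k, u i * pu (x i) / q (x i) :=
    fun hq k x u hu => mul_nonneg (by positivity) (Finset.sum_nonneg fun i _ =>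
      div_nonneg (mul_nonneg (hu i) (hpu_nonneg _)) (hq _))
  refine mem_range_of_exists_le_of_exists_ge (continuous_psi k l xp xm) ?_ ?_
  · obtain ⟨M, hM⟩ := Finset.exists_le ((Finset.range k).image fun i => f (xp i))
    refine ⟨M, sub_nonpos.2 (le_trans (le_of_eq ?_) (hnonneg hqm l xm _ fun _ => negPart_nonneg _))⟩
    rw [Finset.sum_eq_zero fun i hi => ?_, mul_zero]
    rw [posPart_eq_zero.2 (sub_nonpos.2 (hM _ (Finset.mem_image_of_mem _ hi))), zero_mul, zero_div]
  · obtain ⟨M, hM⟩ := ((Finset.range l).image fun i => f (xm i)).bddBelow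
    refine ⟨M, sub_nonneg.2 (le_trans (le_of_eq ?_) (hnonneg hqp k xp _ fun _ => posPart_nonneg _))⟩
    rw [Finset.sum_eq_zero fun i hi => ?_, mul_zero]
    rw [negPart_eq_zero.2 (sub_nonneg.2 (hM (Finset.mem_coe.2 (Finset.mem_image_of_mem _ hi)))),
      zero_mul, zero_div]

/-- A point of the positive sample above a point of the negative sample makes the zero of the
estimating function unique. -/
theorem exists_isUniqueZero_psi (hpu_nonneg : ∀ x, 0 ≤ pu x) (hqp : ∀ x, 0 ≤ qp x)
    (hqm : ∀ x, 0 ≤ qm x) {k l i j : ℕ} (hi : i < k) (hj : j < l)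
    {xp xm : ℕ → EuclideanSpace ℝ (Fin d)} (hf : f (xm j) < f (xp i)) (hpi : 0 < pu (xp i))
    (hpj : 0 < pu (xm j)) (hqi : 0 < qp (xp i)) (hqj : 0 < qm (xm j)) :
    ∃ m, IsUniqueZero (psi f pu qp qm k l xp xm) m := by
  have hlt : ∀ a b, a < b → psi f pu qp qm k l xp xm b < psi f pu qp qm k l xp xm a := by
    intro a b hab
    -- If `a < f (xp i)` the positive sum drops strictly from `a` to `b`; otherwise `f (xm j) < f
    -- (xp i) ≤ a < b` and the negative sum grows strictly.
    rcases lt_or_ge a (f (xp i)) with ha | ha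
    · have h1 := sum_posPart_lt hpu_nonneg hqp hi hab ha hpi hqi
      have h2 := monotone_sum_negPart (f := f) hpu_nonneg hqm l xm hab.le
      simp only [psi] at h2 ⊢
      linarith
    · have h1 := antitone_sum_posPart (f := f) hpu_nonneg hqp k xp hab.le
      have h2 := sum_negPart_lt hpu_nonneg hqm hj hab ((hf.trans_le ha).trans hab) hpj hqj
      simp only [psi] at h1 ⊢
      linarith
  obtain ⟨m, hm⟩ := exists_psi_eq_zero (f := f) hpu_nonneg hqp hqm k l xp xm
  refine ⟨m, hm, fun μ hμ => ?_⟩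
  rcases lt_trichotomy μ m with h | h | h
  · exact absurd (hlt _ _ h) (by rw [hm, hμ]; exact lt_irrefl _)
  · exact h
  · exact absurd (hlt _ _ h) (by rw [hm, hμ]; exact lt_irrefl _)

/-- An i.i.d. sequence almost surely visits every set of positive probability. -/
theorem ae_exists_mem_of_iIndepFun {Ω E : Type*} [MeasurableSpace Ω] [MeasurableSpace E]
    {P : Measure Ω} {ν : Measure E} [IsProbabilityMeasure ν] {X : ℕ → Ω → E}
    (hX : ∀ i, HasLaw (X i) ν P) (hind : iIndepFun X P) {A : Set E} (hA : MeasurableSet A)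
    (hνA : ν A ≠ 0) : ∀ᵐ ω ∂P, ∃ i, X i ω ∈ A := by
  have hI : Measurable (A.indicator fun _ => (1 : ℝ)) := measurable_const.indicator hA
  have hint : Integrable (A.indicator fun _ => (1 : ℝ)) ν :=
    (integrable_const (1 : ℝ)).indicator hA
  -- Visit frequencies tend to `ν A > 0`, whereas they would all be `0` if `A` were never visited.
  have hlim := strong_law_ae_real (μ := P) (fun i ω => A.indicator (fun _ => (1 : ℝ)) (X i ω))
    (((hX 0).map_eq.symm ▸ hint : Integrable (A.indicator fun _ => (1 : ℝ))
      (P.map (X 0))).comp_aemeasurable (hX 0).aemeasurable)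
    (fun i j hij => (hind.indepFun hij).comp hI hI)
    (fun i => ((hX i).identDistrib (hX 0)).comp hI)
  have hmean : ∫ ω, A.indicator (fun _ => (1 : ℝ)) (X 0 ω) ∂P = ν.real A := by
    rw [← integral_indicator_one hA]
    exact (hX 0).integral_comp hI.aestronglyMeasurable
  filter_upwards [hlim] with ω hω
  by_contra! hno
  have h0 : ∀ i, A.indicator (fun _ => (1 : ℝ)) (X i ω) = 0 := fun i =>
    indicator_of_notMem (hno i) _
  simp only [h0, Finset.sum_const_zero, zero_div, hmean] at hω
  have := tendsto_nhds_unique hω tendsto_const_nhds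
  exact hνA ((measureReal_eq_zero_iff).1 this)

theorem IsPDF.law_pos_ne_zero {q g : EuclideanSpace ℝ (Fin d) → ℝ} (hq : IsPDF q)
    (hg0 : ∀ x, 0 ≤ g x) (hm : 0 < ∫ x, g x)
    (hpos : ∀ x, 0 < g x → 0 < q x) : law q {x | 0 < g x} ≠ 0 := by
  intro h
  have h1 : ∀ᵐ x ∂(law q), ¬ 0 < g x := by
    rw [ae_iff]
    simpa using h
  rw [law, ae_withDensity_iff hq.measurable.ennreal_ofReal] at h1
  have h2 : g =ᵐ[volume] 0 := by
    filter_upwards [h1] with x hx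
    by_contra hne
    have hgx := (hg0 x).lt_of_ne' hne
    exact hx (ENNReal.ofReal_pos.2 (hpos x hgx)).ne' hgx
  rw [integral_congr_ae h2] at hm
  simp at hm

end Uniqueness

/-! ### Construction of the samplers -/

section Existence

variable {d : ℕ} {f pu : EuclideanSpace ℝ (Fin d) → ℝ}

theorem isPDF_target (hpu : Measurable pu) (hpu_nonneg : ∀ x, 0 ≤ pu x)
    (hc : 0 < normConst pu) : IsPDF (target pu) :=
  ⟨measurable_target hpu, target_nonneg hpu_nonneg, integral_target hc⟩

/-- The positive and negative parts have equal integrals, so if one vanished both would, and `f`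
would have zero variance under the target. -/
theorem integral_posIntegrand_pos (hf : Measurable f) (hpu : Measurable pu)
    (hpu_nonneg : ∀ x, 0 ≤ pu x) (hpu_int : Integrable pu) (hc : 0 < normConst pu)
    (hmean : Integrable fun x => f x * target pu x)
    (hvar_pos : 0 < ∫ x, (f x - mean f pu) ^ 2 * target pu x) :
    0 < ∫ x, posIntegrand f pu x := by
  have hge : 0 ≤ ∫ x, posIntegrand f pu x := integral_nonneg (posIntegrand_nonneg hpu_nonneg)
  refine hge.lt_of_ne' fun h0 => ?_
  have h1 := (integral_eq_zero_iff_of_nonneg (posIntegrand_nonneg hpu_nonneg)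
    (integrable_posIntegrand hf hpu hpu_int hmean)).1 h0
  rw [integral_posIntegrand_eq hf hpu hpu_int hc hmean] at h0
  have h2 := (integral_eq_zero_iff_of_nonneg (negIntegrand_nonneg hpu_nonneg)
    (integrable_negIntegrand hf hpu hpu_int hmean)).1 h0
  have h3 : (fun x => (f x - mean f pu) ^ 2 * target pu x) =ᵐ[volume] 0 := by
    filter_upwards [h1, h2] with x hx1 hx2
    have h4 : (f x - mean f pu) * target pu x = posIntegrand f pu x - negIntegrand f pu x := by
      rw [posIntegrand, negIntegrand, ← sub_mul, posPart_sub_negPart]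
    rw [sq, mul_assoc, h4, hx1, hx2]
    simp
  rw [integral_congr_ae h3] at hvar_pos
  simp at hvar_pos

/-- Equality would make `f - μ₀` equal to the constant `m > 0` almost everywhere under the target,
although its mean is `0`. This excludes zero variance of the mixture. -/
theorem not_ae_posIntegrand_eq_mul_target (hpu_int : Integrable pu)
    (hc : 0 < normConst pu) (hmean : Integrable fun x => f x * target pu x)
    (hm : 0 < ∫ x, posIntegrand f pu x) :
    ¬ ∀ᵐ x, posIntegrand f pu x = (∫ y, posIntegrand f pu y) * target pu x := by
  intro h
  set m := ∫ y, posIntegrand f pu y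
  have h1 : (fun x => (f x - mean f pu) * target pu x) =ᵐ[volume] fun x => m * target pu x := by
    filter_upwards [h] with x hx
    rw [posIntegrand] at hx
    rcases eq_or_ne (target pu x) 0 with h0 | h0
    · simp [h0]
    · have h2 := mul_right_cancel₀ h0 hx
      have h3 : 0 < f x - mean f pu := posPart_pos_iff.1 (h2 ▸ hm)
      rw [← h2, posPart_eq_self.2 h3.le]
  have h2 := integral_congr_ae h1
  rw [integral_centered hpu_int hc hmean, integral_const_mul, integral_target hc, mul_one] at h2
  exact hm.ne h2

/-- Admissible samplers close to the optimal ones, of arbitrarily small asymptotic variance. -/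
theorem exists_samplers (hf : Measurable f) (hpu : Measurable pu)
    (hpu_nonneg : ∀ x, 0 ≤ pu x) (hpu_int : Integrable pu) (hc : 0 < normConst pu)
    (hmean : Integrable fun x => f x * target pu x)
    (hvar_pos : 0 < ∫ x, (f x - mean f pu) ^ 2 * target pu x)
    {θ : ℝ} (hθ : θ ∈ Ioo (0 : ℝ) 1) {ε : ℝ} (hε : 0 < ε) :
    ∃ qp qm : EuclideanSpace ℝ (Fin d) → ℝ,
      IsPDF qp ∧ IsPDF qm ∧ (∀ x, 0 < pu x → 0 < qp x) ∧ (∀ x, 0 < pu x → 0 < qm x) ∧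
      oisVar (posIntegrand f pu) qp ≠ ⊤ ∧ oisVar (negIntegrand f pu) qm ≠ ⊤ ∧
      ∫ x, |qp x - normalized (posIntegrand f pu) x| < ε ∧
      ∫ x, |qm x - normalized (negIntegrand f pu) x| < ε ∧
      0 < asympVar f pu qp qm θ ∧ asympVar f pu qp qm θ < ε := by
  have hθ' : 0 < 1 - θ := sub_pos.2 hθ.2
  have hp := isPDF_target hpu hpu_nonneg hc
  have hgp := measurable_posIntegrand hf hpu
  have hgm := measurable_negIntegrand hf hpu
  have hgp0 := posIntegrand_nonneg (f := f) hpu_nonneg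
  have hgm0 := negIntegrand_nonneg (f := f) hpu_nonneg
  have hmp := integral_posIntegrand_pos hf hpu hpu_nonneg hpu_int hc hmean hvar_pos
  have heq := integral_posIntegrand_eq hf hpu hpu_int hc hmean
  have hmm := heq ▸ hmp
  set m := ∫ x, posIntegrand f pu x
  set K := 2 * m ^ 2 * (1 / θ + 1 / (1 - θ)) with hK
  have hKpos : 0 < K := by
    have := hθ.1
    positivity
  -- `2 δ` bounds the `L¹` distances and `K δ` the asymptotic variance. The `3` in `δ = min (1 / 2)
  -- (ε / (3 + K))` makes both inequalities strict.
  obtain ⟨δ, hδ, hδ1, hδε, hδK⟩ : ∃ δ : ℝ, 0 < δ ∧ δ ≤ 1 / 2 ∧ 2 * δ < ε ∧ K * δ < ε := by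
    have h3 : 0 < 3 + K := by linarith
    have hle : min (1 / 2) (ε / (3 + K)) * (3 + K) ≤ ε :=
      (le_div_iff₀ h3).1 (min_le_right _ _)
    have hpos : 0 < min (1 / 2) (ε / (3 + K)) := lt_min one_half_pos (div_pos hε h3)
    refine ⟨_, hpos, min_le_left _ _, ?_, ?_⟩ <;> nlinarith
  have hδ1' : δ ≤ 1 := by linarith
  have hvp := oisVar_defensiveMixture_le hgp hgp0 hmp hp hδ hδ1
  have hvm := oisVar_defensiveMixture_le hgm hgm0 hmm hp hδ hδ1
  rw [← heq] at hvm
  have hvpt := (hvp.trans_lt ENNReal.ofReal_lt_top).ne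
  have hvmt := (hvm.trans_lt ENNReal.ofReal_lt_top).ne
  refine ⟨defensiveMixture (posIntegrand f pu) (target pu) δ,
    defensiveMixture (negIntegrand f pu) (target pu) δ,
    isPDF_defensiveMixture hgp hgp0 hmp hp hδ.le hδ1',
    isPDF_defensiveMixture hgm hgm0 hmm hp hδ.le hδ1',
    fun x hx => defensiveMixture_pos hgp0 hδ hδ1' ((target_pos_iff hc).2 hx),
    fun x hx => defensiveMixture_pos hgm0 hδ hδ1' ((target_pos_iff hc).2 hx), hvpt, hvmt,
    (integral_abs_defensiveMixture_sub_le hgp hgp0 hmp hp hδ.le).trans_lt hδε,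
    (integral_abs_defensiveMixture_sub_le hgm hgm0 hmm hp hδ.le).trans_lt hδε, ?_, ?_⟩
  · refine add_pos_of_pos_of_nonneg (div_pos (ENNReal.toReal_pos (fun h0 => ?_) hvpt) hθ.1)
      (div_nonneg ENNReal.toReal_nonneg hθ'.le)
    exact not_ae_posIntegrand_eq_mul_target hpu_int hc hmean hmp
      (ae_eq_of_oisVar_defensiveMixture_eq_zero hgp hgp0 hmp hp hδ hδ1' h0)
  · have hb : 0 ≤ 2 * m ^ 2 * δ := by positivity
    refine (add_le_add (div_le_div_of_nonneg_right (ENNReal.toReal_le_of_le_ofReal hb hvp) hθ.1.le)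
      (div_le_div_of_nonneg_right (ENNReal.toReal_le_of_le_ofReal hb hvm) hθ'.le)).trans_lt ?_
    refine lt_of_eq_of_lt ?_ hδK
    rw [hK]
    ring

/-- Samplers positive on the support of the target almost surely give a unique zero for all
sufficiently large sample sizes. -/
theorem ae_eventually_exists_isUniqueZero (hf : Measurable f) (hpu : Measurable pu)
    (hpu_nonneg : ∀ x, 0 ≤ pu x) (hpu_int : Integrable pu) (hc : 0 < normConst pu)
    (hmean : Integrable fun x => f x * target pu x)
    (hvar_pos : 0 < ∫ x, (f x - mean f pu) ^ 2 * target pu x)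
    {np nm : ℕ → ℕ} (hmin : Tendsto (fun n => min (np n) (nm n)) atTop atTop)
    {qp qm : EuclideanSpace ℝ (Fin d) → ℝ} (hqp : IsPDF qp) (hqm : IsPDF qm)
    (hqp_pos : ∀ x, 0 < pu x → 0 < qp x) (hqm_pos : ∀ x, 0 < pu x → 0 < qm x)
    {Ω : Type*} [MeasurableSpace Ω] {P : Measure Ω}
    {Xp Xm : ℕ → Ω → EuclideanSpace ℝ (Fin d)} (hX : IsSample P qp qm Xp Xm) :
    ∀ᵐ ω ∂P, ∀ᶠ n in atTop, ∃ m : ℝ, IsUniqueZero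
      (psi f pu qp qm (np n) (nm n) (fun i => Xp i ω) (fun i => Xm i ω)) m := by
  have hmp := integral_posIntegrand_pos hf hpu hpu_nonneg hpu_int hc hmean hvar_pos
  have hmm := integral_posIntegrand_eq hf hpu hpu_int hc hmean ▸ hmp
  have hgp := measurable_posIntegrand hf hpu
  have hgm := measurable_negIntegrand hf hpu
  have hpos : ∀ x, 0 < posIntegrand f pu x → mean f pu < f x ∧ 0 < pu x := fun x hx =>
    ⟨sub_pos.1 (posPart_pos_iff.1 (pos_of_mul_pos_left hx (target_nonneg hpu_nonneg x))),
      (target_pos_iff hc).1 (pos_of_mul_pos_right hx (posPart_nonneg _))⟩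
  have hneg : ∀ x, 0 < negIntegrand f pu x → f x < mean f pu ∧ 0 < pu x := fun x hx =>
    ⟨sub_neg.1 (negPart_pos_iff.1 (pos_of_mul_pos_left hx (target_nonneg hpu_nonneg x))),
      (target_pos_iff hc).1 (pos_of_mul_pos_right hx (negPart_nonneg _))⟩
  have := hqp.isProbabilityMeasure_law
  have := hqm.isProbabilityMeasure_law
  have h1 := ae_exists_mem_of_iIndepFun hX.law_pos hX.indep_pos
    (measurableSet_lt measurable_const hgp)
    (hqp.law_pos_ne_zero (posIntegrand_nonneg hpu_nonneg) hmp
      fun x hx => hqp_pos x (hpos x hx).2)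
  have h2 := ae_exists_mem_of_iIndepFun hX.law_neg hX.indep_neg
    (measurableSet_lt measurable_const hgm)
    (hqm.law_pos_ne_zero (negIntegrand_nonneg hpu_nonneg) hmm
      fun x hx => hqm_pos x (hneg x hx).2)
  filter_upwards [h1, h2] with ω ⟨i, hi⟩ ⟨j, hj⟩
  have hi' := hpos _ hi
  have hj' := hneg _ hj
  filter_upwards [hmin.eventually_gt_atTop (max i j)] with n hn
  have hn' := lt_min_iff.1 hn
  exact exists_isUniqueZero_psi hpu_nonneg hqp.nonneg hqm.nonneg
    ((le_max_left i j).trans_lt hn'.1) ((le_max_right i j).trans_lt hn'.2)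
    (hj'.1.trans hi'.1) hi'.2 hj'.2 (hqp_pos _ hi'.2) (hqm_pos _ hj'.2)

end Existence

end EESNIS

end

theorem theorem1 {d : ℕ} (f pu : EuclideanSpace ℝ (Fin d) → ℝ)
    (hf : Measurable f) (hpu : Measurable pu) (hpu_nonneg : ∀ x, 0 ≤ pu x)
    (hpu_int : Integrable pu) (hc : 0 < EESNIS.normConst pu)
    (hmean : Integrable fun x => f x * EESNIS.target pu x)
    (hvar_int : Integrable fun x => (f x - EESNIS.mean f pu) ^ 2 * EESNIS.target pu x)
    (hvar_pos : 0 < ∫ x, (f x - EESNIS.mean f pu) ^ 2 * EESNIS.target pu x)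
    (np nm : ℕ → ℕ) (hnp : Monotone np) (hnm : Monotone nm)
    (hmin : Tendsto (fun n => min (np n) (nm n)) atTop atTop)
    (θ : ℝ) (hθ : θ ∈ Ioo (0 : ℝ) 1)
    (hθp : Tendsto (fun n => (np n : ℝ) / (n : ℝ)) atTop (𝓝 θ))
    (hθm : Tendsto (fun n => (nm n : ℝ) / (n : ℝ)) atTop (𝓝 (1 - θ))) :
    -- the central limit theorem
    (∀ qp qm : EuclideanSpace ℝ (Fin d) → ℝ,
      EESNIS.IsPDF qp → EESNIS.IsPDF qm → EESNIS.SupportCondition f pu qp qm →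
      EESNIS.oisVar (EESNIS.posIntegrand f pu) qp ≠ ⊤ →
      EESNIS.oisVar (EESNIS.negIntegrand f pu) qm ≠ ⊤ →
      0 < EESNIS.asympVar f pu qp qm θ →
      ∀ (Ω : Type*) [MeasurableSpace Ω] (P : Measure Ω) [IsProbabilityMeasure P]
        (Xp Xm : ℕ → Ω → EuclideanSpace ℝ (Fin d)), EESNIS.IsSample P qp qm Xp Xm →
      ∀ μhat : ℕ → Ω → ℝ,
        -- with probability tending to one, the estimator is the unique zero
        Tendsto (fun n => P {ω | ¬ EESNIS.IsUniqueZero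
          (EESNIS.psi f pu qp qm (np n) (nm n) (fun i => Xp i ω) (fun i => Xm i ω))
          (μhat n ω)}) atTop (𝓝 0) →
      ∀ t : ℝ, Tendsto (fun n : ℕ => P.real {ω |
          √(n : ℝ) * (μhat n ω - EESNIS.mean f pu) / √(EESNIS.asympVar f pu qp qm θ) ≤ t})
        atTop (𝓝 (cdf (gaussianReal 0 1) t))) ∧
    -- the asymptotic variance can be made arbitrarily small by admissible samplers close to
    -- the densities proportional to the positive and negative parts
    (∀ ε : ℝ, 0 < ε → ∃ qp qm : EuclideanSpace ℝ (Fin d) → ℝ,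
      EESNIS.IsPDF qp ∧ EESNIS.IsPDF qm ∧ EESNIS.SupportCondition f pu qp qm ∧
      EESNIS.oisVar (EESNIS.posIntegrand f pu) qp ≠ ⊤ ∧
      EESNIS.oisVar (EESNIS.negIntegrand f pu) qm ≠ ⊤ ∧
      ∫ x, |qp x - EESNIS.normalized (EESNIS.posIntegrand f pu) x| < ε ∧
      ∫ x, |qm x - EESNIS.normalized (EESNIS.negIntegrand f pu) x| < ε ∧
      0 < EESNIS.asympVar f pu qp qm θ ∧ EESNIS.asympVar f pu qp qm θ < ε ∧
      ∀ (Ω : Type*) [MeasurableSpace Ω] (P : Measure Ω) [IsProbabilityMeasure P]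
        (Xp Xm : ℕ → Ω → EuclideanSpace ℝ (Fin d)), EESNIS.IsSample P qp qm Xp Xm →
        ∀ᵐ ω ∂P, ∀ᶠ n in atTop, ∃ m : ℝ, EESNIS.IsUniqueZero
          (EESNIS.psi f pu qp qm (np n) (nm n) (fun i => Xp i ω) (fun i => Xm i ω)) m) := by
  refine ⟨?_, ?_⟩
  · intro qp qm hqp hqm hsupp hvp hvm hσ Ω _ P _ Xp Xm hX μhat hzero t
    exact EESNIS.tendsto_measureReal_estimator_le hf hpu hpu_nonneg hpu_int hc hmean hmin hθ hθp hθm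
      hqp hqm hsupp hvp hvm hσ hX hzero t
  · intro ε hε
    obtain ⟨qp, qm, hqp, hqm, hqp_pos, hqm_pos, hvp, hvm, hcp, hcm, hσ, hσε⟩ :=
      EESNIS.exists_samplers hf hpu hpu_nonneg hpu_int hc hmean hvar_pos hθ hε
    -- The choice `η = 1` is arbitrary: samplers positive wherever `pu` is satisfy the support
    -- condition at every `μ`.
    refine ⟨qp, qm, hqp, hqm, ⟨1, one_pos, fun μ _ x => ⟨fun hx => hqp_pos x ?_,
      fun hx => hqm_pos x ?_⟩⟩, hvp, hvm, hcp, hcm, hσ, hσε, ?_⟩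
    · exact pos_of_mul_pos_right hx (posPart_nonneg _)
    · exact pos_of_mul_pos_right hx (negPart_nonneg _)
    · intro Ω _ P _ Xp Xm hX
      exact EESNIS.ae_eventually_exists_isUniqueZero hf hpu hpu_nonneg hpu_int hc hmean hvar_pos
        hmin hqp hqm hqp_pos hqm_pos hX
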